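/- Let $(\Omega,\Sigma)$ be a measurable space. Let $B(\Omega,\Sigma)$ be the set of bounded measurable functions $\Omega\to\mathbb R$, $\mathcal P(\Omega,\Sigma)$ the set of finitely additive probability measures on $(\Omega,\Sigma)$, and $\mathcal P_c(\Omega,\Sigma)\subseteq\mathcal P(\Omega,\Sigma)$ the subset of countably additive ones. Write $\mathbb E_P[h]$ for the integral of $h\in B(\Omega,\Sigma)$ with respect to $P\in\mathcal P(\Omega,\Sigma)$, and $P'\ll Q$ if $Q(E)=0$ implies $P'(E)=0$ for every $E\in\Sigma$. Let $f:\mathbb R\to(-\infty,\infty]$ be convex and lower semicontinuous, with $f(1)=0$, $f$ finite in a neighbourhood of $1$, and $f(x)=\infty$ for all $x<0$. Let $f^*(s)=\sup_{x\in\mathbb R}\,(xs-f(x))$. For $P'\in\mathcal P(\Omega,\Sigma)$ and $Q\in\mathcal P_c(\Omega,\Sigma)$ put $$\bar D_f(P'\|Q)=\begin{cases}\displaystyle\int_\Omega f\Big(\frac{dP'}{dQ}\Big)\,dQ,&\text{if }P'\in\mathcal P_c(\Omega,\Sigma)\text{ and }P'\ll Q,\\[2mm]\displaystyle\sup_{h\in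 B(\Omega,\Sigma)}\big(\mathbb E_{P'}[h]-\mathbb E_Q[f^*(h)]\big),&\text{otherwise.}\end{cases}$$ Let $n\in\mathbb{N}$, let $\varphi=(\varphi_1,\dots,\varphi_n)$ with $\varphi_i\in B(\Omega,\Sigma)$, and for $A\subseteq\mathbb R^n$ put $$D_{f,\varphi,A}(P\|Q)=\sup_{a\in A,\;b\in\mathbb R}\Big(\mathbb E_P[a^{\intercal}\varphi+b]-\mathbb E_Q\big[f^*(a^{\intercal}\varphi+b)\big]\Big).$$ Let $R>0$ and $A=\{x\in\mathbb R^n:\|x\|_2\le R\}$. Then for all $P\in\mathcal P(\Omega,\Sigma)$ and $Q\in\mathcal P_c(\Omega,\Sigma)$, as equalities in $[-\infty,\infty]$, $$D_{f,\varphi,A}(P\|Q)=\inf_{P'\in\mathcal P(\Omega,\Sigma)}\Big(R\,\big\|\mathbb E_P[\varphi]-\mathbb E_{P'}[\varphi]\big\|_2+\bar D_f(P'\|Q)\Big)=\inf_{\substack{P'\in\mathcal P(\Omega,\Sigma)\\ P'\ll Q}}\Big(R\,\big\|\mathbb E_P[\varphi]-\mathbb E_{P'}[\varphi]\big\|_2+\bar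 D_f(P'\|Q)\Big).$$ Moreover, let $f_0(x)=x\ln x$ for $x\ge 0$ (with $0\ln 0=0$) and $f_0(x)=\infty$ for $x<0$, and for $P'\ll Q$ let $\overline{\mathrm{KL}}(P'\|Q)$ be the Kullback–Leibler divergence $\mathrm{KL}(P'\|Q)$ if $P'\in\mathcal P_c(\Omega,\Sigma)$, and $\sup_{h\in B(\Omega,\Sigma)}\big(\mathbb E_{P'}[h]-\mathbb E_Q[\exp(h-1)]\big)$ otherwise. Then $\bar D_{f_0}(P'\|Q)=\overline{\mathrm{KL}}(P'\|Q)$ for every $P'\in\mathcal P(\Omega,\Sigma)$ with $P'\ll Q$, and $$D_{f_0,\varphi,A}(P\|Q)=\inf_{\substack{P'\in\mathcal P(\Omega,\Sigma)\\ P'\ll Q}}\Big(R\,\big\|\mathbb E_P[\varphi]-\mathbb E_{P'}[\varphi]\big\|_2+\overline{\mathrm{KL}}(P'\|Q)\Big).$$ -/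

import Mathlib

open MeasureTheory Filter Topology
open scoped ENNReal

namespace FGAN

noncomputable section

/-- The space `B(Ω, Σ)` of bounded measurable real-valued functions. -/
def BoundedMeasurable (Ω : Type*) [MeasurableSpace Ω] : Set (Ω → ℝ) :=
  {h | Measurable h ∧ ∃ C : ℝ, ∀ x, |h x| ≤ C}

/-- The set `𝒫(Ω, Σ)` of finitely additive probability measures. Only the values on measurable
sets matter. -/
structure FinAddProb (Ω : Type*) [MeasurableSpace Ω] where
  /-- the mass of a set -/
  mass : Set Ω → ℝ
  mass_nonneg : ∀ E, MeasurableSet E → 0 ≤ mass E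
  mass_union : ∀ E F, MeasurableSet E → MeasurableSet F → Disjoint E F →
    mass (E ∪ F) = mass E + mass F
  mass_univ : mass Set.univ = 1

namespace FinAddProb

variable {Ω : Type*} [MeasurableSpace Ω]

theorem mass_empty (P : FinAddProb Ω) : P.mass ∅ = 0 := by
  have h := P.mass_union ∅ ∅ MeasurableSet.empty MeasurableSet.empty (Set.disjoint_empty _)
  rw [Set.union_empty] at h
  linarith

/-- The expectation `E_P[h]` of a bounded measurable function `h`: the supremum of the elementary
integrals of the measurable simple functions below `h`. -/
def expect (P : FinAddProb Ω) (h : Ω → ℝ) : ℝ :=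
  sSup {r : ℝ | ∃ g : SimpleFunc Ω ℝ, (∀ x, g x ≤ h x) ∧
    r = ∑ y ∈ g.range, y * P.mass (g ⁻¹' {y})}

/-- The vector `E_P[φ]` of the expectations of the coordinates of `φ`. -/
def expectVec {n : ℕ} (P : FinAddProb Ω) (φ : Fin n → Ω → ℝ) : EuclideanSpace ℝ (Fin n) :=
  WithLp.toLp 2 (fun i => P.expect (φ i))

/-- Countable additivity, that is, membership in `𝒫_c(Ω, Σ)`. -/
def IsCountablyAdditive (P : FinAddProb Ω) : Prop :=
  ∀ E : ℕ → Set Ω, (∀ i, MeasurableSet (E i)) → Pairwise (Function.onFun Disjoint E) →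
    HasSum (fun i => P.mass (E i)) (P.mass (⋃ i, E i))

/-- A countably additive member of `𝒫(Ω, Σ)` as a Mathlib measure. -/
def toMeasure (P : FinAddProb Ω) (hP : P.IsCountablyAdditive) : Measure Ω :=
  Measure.ofMeasurable (fun E _ => ENNReal.ofReal (P.mass E))
    (by rw [P.mass_empty, ENNReal.ofReal_zero])
    (by
      intro E hE hd
      have h := hP E hE hd
      rw [← h.tsum_eq]
      exact ENNReal.ofReal_tsum_of_nonneg (fun i => P.mass_nonneg _ (hE i)) h.summable)

/-- Absolute continuity `P ≪ Q`. -/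
def AbsCont (P : FinAddProb Ω) (Q : Measure Ω) : Prop :=
  ∀ E, MeasurableSet E → Q E = 0 → P.mass E = 0

end FinAddProb

/-- The standing assumptions on `f : ℝ → (-∞, ∞]`: convex, lower semicontinuous, `f 1 = 0`, finite
near `1`, and equal to `∞` on the negative reals. -/
structure IsDivergenceFunction (f : ℝ → EReal) : Prop where
  ne_bot : ∀ x, f x ≠ ⊥
  convex : ∀ x y a b : ℝ, 0 < a → 0 < b → a + b = 1 →
    f (a * x + b * y) ≤ (a : EReal) * f x + (b : EReal) * f y
  lsc : LowerSemicontinuous f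
  map_one : f 1 = 0
  finite_near_one : ∀ᶠ x in 𝓝 (1 : ℝ), f x ≠ ⊤
  top_of_neg : ∀ x, x < 0 → f x = ⊤

/-- The convex conjugate `f^*(s) = sup_x (x s - f x)`. -/
def conj (f : ℝ → EReal) (s : ℝ) : EReal :=
  ⨆ x : ℝ, ((x * s : ℝ) : EReal) - f x

/-- The integral of an extended-real-valued function, as the integral of its positive part minus
the integral of its negative part (used only where the latter is finite). -/
def eintegral {Ω : Type*} [MeasurableSpace Ω] (Q : Measure Ω) (g : Ω → EReal) : EReal :=
  ((∫⁻ x, (g x).toENNReal ∂Q : ℝ≥0∞) : EReal) - ((∫⁻ x, (-g x).toENNReal ∂Q : ℝ≥0∞) : EReal)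

section Divergences

variable {Ω : Type*} [MeasurableSpace Ω]

/-- The `f`-divergence `D_f(P‖Q) = ∫ f(dP/dQ) dQ` of measures with `P ≪ Q`. -/
def fDiv (f : ℝ → EReal) (P Q : Measure Ω) : EReal :=
  eintegral Q (fun x => f (P.rnDeriv Q x).toReal)

open Classical in
/-- The extended `f`-divergence of a finitely additive probability `P` from `Q`. -/
def fDivBar (f : ℝ → EReal) (P : FinAddProb Ω) (Q : Measure Ω) : EReal :=
  if h : P.IsCountablyAdditive ∧ P.AbsCont Q then fDiv f (P.toMeasure h.1) Q
  else ⨆ h ∈ BoundedMeasurable Ω,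
    ((P.expect h : ℝ) : EReal) - eintegral Q (fun x => conj f (h x))

/-- The linear `f`-divergence: the supremum over the discriminators `aᵀφ + b` with `a ∈ A` and
`b ∈ ℝ` of `E_P[aᵀφ + b] - E_Q[f^*(aᵀφ + b)]`. -/
def linearFDiv {n : ℕ} (f : ℝ → EReal) (φ : Fin n → Ω → ℝ) (A : Set (EuclideanSpace ℝ (Fin n)))
    (P : FinAddProb Ω) (Q : Measure Ω) : EReal :=
  ⨆ a ∈ A, ⨆ b : ℝ,
    ((P.expect (fun x => ∑ i, a i * φ i x + b) : ℝ) : EReal)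
      - eintegral Q (fun x => conj f (∑ i, a i * φ i x + b))

/-- The function `x ↦ x ln x`, with value `0` at `0` and `∞` on the negative reals. -/
def xLogX (x : ℝ) : EReal :=
  if x < 0 then ⊤ else ((x * Real.log x : ℝ) : EReal)

open Classical in
/-- The extended Kullback-Leibler divergence of a finitely additive probability `P` from `Q`
(for `P ≪ Q`). -/
def klDivBar (P : FinAddProb Ω) (Q : Measure Ω) : EReal :=
  if h : P.IsCountablyAdditive then
    ((InformationTheory.klDiv (P.toMeasure h) Q : ℝ≥0∞) : EReal)
  else ⨆ h ∈ BoundedMeasurable Ω,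
    ((P.expect h - ∫ x, Real.exp (h x - 1) ∂Q : ℝ) : EReal)

end Divergences

end

end FGAN

namespace FGAN

noncomputable section

/-! The divergence `fDivBar` has the same variational formula for every finitely additive P': it is
the supremum over bounded h of E_{P'}[h] - E_Q[f^*(h)] (`fDivBar_eq_iSup`). For P' countably
additive with P' ≪ Q this is biconjugation f = f^** under the integral, with the optimal slopes
chosen measurably (`exists_slopes`) and monotone convergence.

Restricting the supremum to h = aᵀφ + b with ‖a‖ ≤ R and moving from P' to P costs at most R‖E_P[φ]
- E_{P'}[φ]‖ by Cauchy-Schwarz; this is `linearFDiv_le`.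

Conversely, let L be a real bound for the linear divergence and Ψ(h) = E_Q[f^*(h)], a convex
functional. Hahn-Banach (`exists_linear_le_of_convex`) gives a linear Λ with Λ(h) - Λ(aᵀφ + b) ≤
Ψ(h) + L - E_P[aᵀφ + b] for all h, b and ‖a‖ ≤ R. As b is free, Λ(1) = 1; as f^* is nondecreasing, Λ
is positive. Hence Λ is the expectation of some finitely additive P'
(`exists_finAddProb_expect_eq`). With a of norm R aligned to E_P[φ] - E_{P'}[φ], the inequality says
that P' has total cost at most L (`exists_le_linearFDiv`). Countable additivity is never needed, and
no topology on the function space enters.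

If P' is not absolutely continuous, its divergence is infinite, so the two infima agree. For x ln x
the conjugate is exp(s - 1), and ∫ dP'/dQ dQ = 1 identifies the divergence with `klDiv`. -/

/-- The bounded measurable functions as a real vector space. -/
def boundedMeasurableSubmodule (Ω : Type*) [MeasurableSpace Ω] : Submodule ℝ (Ω → ℝ) where
  carrier := BoundedMeasurable Ω
  zero_mem' := ⟨measurable_const, 0, by simp⟩
  add_mem' := by
    rintro g h ⟨hg, C, hC⟩ ⟨hh, D, hD⟩
    exact ⟨hg.add hh, C + D, fun x => (abs_add_le _ _).trans (add_le_add (hC x) (hD x))⟩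
  smul_mem' := by
    rintro c h ⟨hh, C, hC⟩
    refine ⟨hh.const_smul c, |c| * C, fun x => ?_⟩
    rw [Pi.smul_apply, smul_eq_mul, abs_mul]
    exact mul_le_mul_of_nonneg_left (hC x) (abs_nonneg c)

/-! ### Bounded measurable functions and their approximation by simple functions -/

section Bounded

variable {Ω : Type*} [MeasurableSpace Ω]

theorem BoundedMeasurable.const (c : ℝ) : (fun _ => c) ∈ BoundedMeasurable Ω :=
  ⟨measurable_const, |c|, fun _ => le_rfl⟩

theorem BoundedMeasurable.simpleFunc (g : SimpleFunc Ω ℝ) : ⇑g ∈ BoundedMeasurable Ω := by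
  refine ⟨g.measurable, ?_⟩
  obtain ⟨C, hC⟩ := (g.finite_range.image (fun y => |y|)).bddAbove
  exact ⟨C, fun x => hC ⟨g x, ⟨x, rfl⟩, rfl⟩⟩

theorem BoundedMeasurable.affine {n : ℕ} {φ : Fin n → Ω → ℝ}
    (hφ : ∀ i, φ i ∈ BoundedMeasurable Ω) (a : Fin n → ℝ) (b : ℝ) :
    (fun x => ∑ i, a i * φ i x + b) ∈ BoundedMeasurable Ω := by
  have h1 : ∑ i, a i • φ i ∈ boundedMeasurableSubmodule Ω :=
    Submodule.sum_mem _ fun i _ => Submodule.smul_mem _ _ (hφ i)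
  have h2 := (boundedMeasurableSubmodule Ω).add_mem h1 (BoundedMeasurable.const b)
  have e : (fun x => ∑ i, a i * φ i x + b) = ∑ i, a i • φ i + fun _ => b := by
    ext x
    simp
  rw [e]
  exact h2

/-- Rounding down to the grid of multiples of ε takes finitely many values because h is bounded. -/
theorem BoundedMeasurable.exists_simpleFunc {h : Ω → ℝ} (hh : h ∈ BoundedMeasurable Ω) {ε : ℝ}
    (hε : 0 < ε) : ∃ g : SimpleFunc Ω ℝ, ∀ x, g x ≤ h x ∧ h x ≤ g x + ε := by
  obtain ⟨hm, C, hC⟩ := hh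
  have hfl : Measurable fun x => ⌊h x / ε⌋ := Int.measurable_floor.comp (hm.div_const ε)
  have hfin : (Set.range fun x => ⌊h x / ε⌋).Finite := by
    refine (Set.finite_Icc ⌊-C / ε⌋ ⌊C / ε⌋).subset ?_
    rintro _ ⟨x, rfl⟩
    have := abs_le.1 (hC x)
    exact ⟨Int.floor_le_floor (by gcongr; exact this.1),
      Int.floor_le_floor (by gcongr; exact this.2)⟩
  let k : SimpleFunc Ω ℤ :=
    ⟨fun x => ⌊h x / ε⌋, fun y => hfl (measurableSet_singleton y), hfin⟩
  refine ⟨k.map fun m : ℤ => (m : ℝ) * ε, fun x => ?_⟩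
  have e : (k.map fun m : ℤ => (m : ℝ) * ε) x = (⌊h x / ε⌋ : ℝ) * ε := rfl
  rw [e]
  have h1 := Int.floor_le (h x / ε)
  have h2 := Int.lt_floor_add_one (h x / ε)
  rw [le_div_iff₀ hε] at h1
  rw [div_lt_iff₀ hε] at h2
  exact ⟨h1, by linarith⟩

/-- A monotone linear functional on bounded measurable functions is squeezed by its values on
simple functions. -/
theorem map_simpleFunc_bounds {h : Ω → ℝ} (hh : h ∈ BoundedMeasurable Ω) {ε : ℝ}
    (Λ : boundedMeasurableSubmodule Ω →ₗ[ℝ] ℝ)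
    (hΛ : ∀ g, (∀ x, 0 ≤ g.1 x) → 0 ≤ Λ g) (hone : Λ ⟨_, BoundedMeasurable.const 1⟩ = 1)
    (g : SimpleFunc Ω ℝ) (hg : ∀ x, g x ≤ h x ∧ h x ≤ g x + ε) :
    Λ ⟨g, BoundedMeasurable.simpleFunc g⟩ ≤ Λ ⟨h, hh⟩ ∧
      Λ ⟨h, hh⟩ ≤ Λ ⟨g, BoundedMeasurable.simpleFunc g⟩ + ε := by
  constructor
  · have := hΛ (⟨h, hh⟩ - ⟨g, BoundedMeasurable.simpleFunc g⟩) fun x => sub_nonneg.2 (hg x).1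
    rw [map_sub] at this
    linarith
  · have := hΛ (⟨g, BoundedMeasurable.simpleFunc g⟩ + ε • ⟨_, BoundedMeasurable.const 1⟩
      - ⟨h, hh⟩) fun x => by
        have := (hg x).2
        simp
        linarith
    rw [map_sub, map_add, map_smul, hone] at this
    simp only [smul_eq_mul, mul_one] at this
    linarith

/-- A linear functional on simple functions is determined by its values on indicators. -/
theorem map_simpleFunc_eq_sum (Λ : boundedMeasurableSubmodule Ω →ₗ[ℝ] ℝ) (m : Set Ω → ℝ)
    (hm : ∀ E (_ : MeasurableSet E) (h : E.indicator (fun _ => (1 : ℝ)) ∈ BoundedMeasurable Ω),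
      Λ ⟨_, h⟩ = m E) (g : SimpleFunc Ω ℝ) :
    Λ ⟨g, BoundedMeasurable.simpleFunc g⟩ = ∑ y ∈ g.range, y * m (g ⁻¹' {y}) := by
  have hind : ∀ y, (g ⁻¹' {y}).indicator (fun _ => (1 : ℝ)) ∈ BoundedMeasurable Ω := fun y =>
    ⟨measurable_const.indicator (g.measurableSet_fiber y), 1, fun x => by
      by_cases hx : x ∈ g ⁻¹' {y} <;> simp [Set.indicator, hx]⟩
  have e : (⟨g, BoundedMeasurable.simpleFunc g⟩ : boundedMeasurableSubmodule Ω) =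
      ∑ y ∈ g.range, y • (⟨_, hind y⟩ : boundedMeasurableSubmodule Ω) := by
    ext x
    simp only [Submodule.coe_sum, Submodule.coe_smul, Finset.sum_apply, Pi.smul_apply, smul_eq_mul]
    rw [Finset.sum_eq_single (g x)]
    · simp
    · intro y _ hy
      simp [Set.indicator, hy.symm]
    · intro hx
      exact absurd (g.mem_range_self x) hx
  rw [e, map_sum]
  refine Finset.sum_congr rfl fun y _ => ?_
  rw [map_smul, hm _ (g.measurableSet_fiber y), smul_eq_mul]

end Bounded

/-! ### Linearity of the expectation under a finitely additive probability -/

namespace FinAddProb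

variable {Ω : Type*} [MeasurableSpace Ω] (P : FinAddProb Ω)

/-- The elementary integral of a simple function. -/
def simpleExpect (g : SimpleFunc Ω ℝ) : ℝ := ∑ y ∈ g.range, y * P.mass (g ⁻¹' {y})

/-- The mass as an operator-valued set function. -/
def massCLM (s : Set Ω) : ℝ →L[ℝ] ℝ := P.mass s • ContinuousLinearMap.id ℝ ℝ

theorem simpleExpect_eq (g : SimpleFunc Ω ℝ) :
    P.simpleExpect g = g.setToSimpleFunc P.massCLM := by
  simp [simpleExpect, SimpleFunc.setToSimpleFunc, massCLM, mul_comm]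

/-- The reference measure only supplies finiteness and integrability side conditions; taking it to
be zero makes them vacuous, so the calculus of `setToSimpleFunc` applies to a merely finitely
additive mass. -/
theorem massCLM_additive : FinMeasAdditive (0 : Measure Ω) P.massCLM := by
  intro s t hs ht _ _ hd
  simp [massCLM, P.mass_union s t hs ht hd, add_smul]

theorem simpleExpect_add (g h : SimpleFunc Ω ℝ) :
    P.simpleExpect (g + h) = P.simpleExpect g + P.simpleExpect h := by
  simp only [simpleExpect_eq]
  exact SimpleFunc.setToSimpleFunc_add _ P.massCLM_additive integrable_zero_measure
    integrable_zero_measure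

theorem simpleExpect_smul (c : ℝ) (g : SimpleFunc Ω ℝ) :
    P.simpleExpect (c • g) = c * P.simpleExpect g := by
  simp only [simpleExpect_eq]
  exact SimpleFunc.setToSimpleFunc_smul_real _ P.massCLM_additive c integrable_zero_measure

theorem simpleExpect_mono {g h : SimpleFunc Ω ℝ} (hgh : ∀ x, g x ≤ h x) :
    P.simpleExpect g ≤ P.simpleExpect h := by
  have h0 : 0 ≤ P.simpleExpect (h + (-1 : ℝ) • g) := by
    rw [simpleExpect_eq]
    refine SimpleFunc.setToSimpleFunc_nonneg' (μ := 0) _ (fun s hs _ x hx => ?_) _ (fun x => ?_)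
      integrable_zero_measure
    · simpa [massCLM] using mul_nonneg (P.mass_nonneg s hs) hx
    · simpa using hgh x
  rw [simpleExpect_add, simpleExpect_smul] at h0
  linarith

theorem nonempty (P : FinAddProb Ω) : Nonempty Ω := by
  by_contra h
  rw [not_nonempty_iff] at h
  have h1 := P.mass_univ
  rw [Set.univ_eq_empty_iff.2 h, P.mass_empty] at h1
  exact zero_ne_one h1

theorem simpleExpect_const (c : ℝ) : P.simpleExpect (SimpleFunc.const Ω c) = c := by
  have := P.nonempty
  have : (Function.const Ω c) ⁻¹' {c} = Set.univ := by ext; simp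
  simp [simpleExpect, this, P.mass_univ]

theorem simpleExpect_indicator {E : Set Ω} (hE : MeasurableSet E) :
    P.simpleExpect (SimpleFunc.piecewise E hE (SimpleFunc.const Ω 1) (SimpleFunc.const Ω 0))
      = P.mass E := by
  rw [simpleExpect_eq, SimpleFunc.setToSimpleFunc_indicator _ (by simp [massCLM, P.mass_empty]) hE]
  simp [massCLM]

theorem simpleExpect_le_expect {h : Ω → ℝ} (hh : h ∈ BoundedMeasurable Ω) {g : SimpleFunc Ω ℝ}
    (hg : ∀ x, g x ≤ h x) : P.simpleExpect g ≤ P.expect h := by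
  obtain ⟨_, C, hC⟩ := hh
  refine le_csSup ⟨C, ?_⟩ ⟨g, hg, rfl⟩
  rintro _ ⟨k, hk, rfl⟩
  rw [← P.simpleExpect_const C]
  exact P.simpleExpect_mono fun x => (hk x).trans (abs_le.1 (hC x)).2

theorem expect_le_simpleExpect {h : Ω → ℝ} (hh : h ∈ BoundedMeasurable Ω) {g : SimpleFunc Ω ℝ}
    (hg : ∀ x, h x ≤ g x) : P.expect h ≤ P.simpleExpect g := by
  obtain ⟨_, C, hC⟩ := hh
  refine csSup_le ⟨_, SimpleFunc.const Ω (-C), fun x => (abs_le.1 (hC x)).1, rfl⟩ ?_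
  rintro _ ⟨k, hk, rfl⟩
  exact P.simpleExpect_mono fun x => (hk x).trans (hg x)

theorem expect_mem_Icc {h : Ω → ℝ} (hh : h ∈ BoundedMeasurable Ω) {g : SimpleFunc Ω ℝ} {ε : ℝ}
    (hg : ∀ x, g x ≤ h x ∧ h x ≤ g x + ε) :
    P.simpleExpect g ≤ P.expect h ∧ P.expect h ≤ P.simpleExpect g + ε := by
  refine ⟨P.simpleExpect_le_expect hh fun x => (hg x).1, ?_⟩
  have := P.expect_le_simpleExpect (g := g + SimpleFunc.const Ω ε) hh fun x => (hg x).2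
  rwa [simpleExpect_add, simpleExpect_const] at this

theorem expect_simpleFunc (g : SimpleFunc Ω ℝ) : P.expect g = P.simpleExpect g :=
  le_antisymm (P.expect_le_simpleExpect (BoundedMeasurable.simpleFunc g) fun _ => le_rfl)
    (P.simpleExpect_le_expect (BoundedMeasurable.simpleFunc g) fun _ => le_rfl)

theorem expect_add {g h : Ω → ℝ} (hg : g ∈ BoundedMeasurable Ω) (hh : h ∈ BoundedMeasurable Ω) :
    P.expect (g + h) = P.expect g + P.expect h := by
  -- Both sides lie within 2ε of the same elementary integral. The summand 0 gives the shape that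
  -- `le_of_forall_pos_le_add` expects.
  have key : ∀ ε > 0, |P.expect (g + h) - (P.expect g + P.expect h)| ≤ 0 + 2 * ε := by
    intro ε hε
    obtain ⟨g', hg'⟩ := BoundedMeasurable.exists_simpleFunc hg hε
    obtain ⟨h', hh'⟩ := BoundedMeasurable.exists_simpleFunc hh hε
    have h1 := P.expect_mem_Icc hg hg'
    have h2 := P.expect_mem_Icc hh hh'
    have h3 := P.expect_mem_Icc (g := g' + h') (ε := 2 * ε)
      ((boundedMeasurableSubmodule Ω).add_mem hg hh) (fun x => by
        have := hg' x
        have := hh' x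
        simp only [SimpleFunc.coe_add, Pi.add_apply]
        constructor <;> linarith)
    rw [simpleExpect_add] at h3
    rw [abs_le]
    constructor <;> linarith
  have := le_of_forall_pos_le_add fun ε (hε : (0 : ℝ) < ε) =>
    (key (ε / 2) (half_pos hε)).trans_eq (show 0 + 2 * (ε / 2) = 0 + ε by ring)
  exact sub_eq_zero.1 (abs_nonpos_iff.1 this)

theorem expect_const (c : ℝ) : P.expect (fun _ => c) = c :=
  (P.expect_simpleFunc (SimpleFunc.const Ω c)).trans (P.simpleExpect_const c)

theorem expect_neg {h : Ω → ℝ} (hh : h ∈ BoundedMeasurable Ω) : P.expect (-h) = -P.expect h := by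
  have h1 := P.expect_add hh ((boundedMeasurableSubmodule Ω).neg_mem hh)
  have h2 : P.expect (h + -h) = 0 := by
    rw [add_neg_cancel]
    exact P.expect_const 0
  linarith

theorem expect_smul_of_pos {c : ℝ} (hc : 0 < c) {h : Ω → ℝ} (hh : h ∈ BoundedMeasurable Ω) :
    P.expect (c • h) = c * P.expect h := by
  have key : ∀ ε > 0, |P.expect (c • h) - c * P.expect h| ≤ 0 + c * ε := by
    intro ε hε
    obtain ⟨h', hh'⟩ := BoundedMeasurable.exists_simpleFunc hh hε
    have h2 := P.expect_mem_Icc hh hh'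
    have h3 := P.expect_mem_Icc (g := c • h') (ε := c * ε)
      ((boundedMeasurableSubmodule Ω).smul_mem c hh) (fun x => by
        have := hh' x
        simp only [SimpleFunc.coe_smul, Pi.smul_apply, smul_eq_mul]
        constructor <;> nlinarith)
    rw [simpleExpect_smul] at h3
    rw [abs_le]
    constructor <;> nlinarith
  have := le_of_forall_pos_le_add fun ε (hε : (0 : ℝ) < ε) =>
    (key (ε / c) (div_pos hε hc)).trans_eq (show 0 + c * (ε / c) = 0 + ε by field_simp)
  exact sub_eq_zero.1 (abs_nonpos_iff.1 this)

theorem expect_smul (c : ℝ) {h : Ω → ℝ} (hh : h ∈ BoundedMeasurable Ω) :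
    P.expect (c • h) = c * P.expect h := by
  rcases lt_trichotomy c 0 with hc | rfl | hc
  · have h1 := P.expect_smul_of_pos (neg_pos.2 hc) hh
    rw [neg_smul, P.expect_neg ((boundedMeasurableSubmodule Ω).smul_mem c hh)] at h1
    linarith
  · rw [zero_smul, zero_mul]
    exact P.expect_const 0
  · exact P.expect_smul_of_pos hc hh

/-- The expectation as a linear functional. -/
def expectLinear : boundedMeasurableSubmodule Ω →ₗ[ℝ] ℝ where
  toFun h := P.expect h
  map_add' g h := P.expect_add g.2 h.2
  map_smul' c h := P.expect_smul c h.2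

theorem expect_affine {n : ℕ} {φ : Fin n → Ω → ℝ} (hφ : ∀ i, φ i ∈ BoundedMeasurable Ω)
    (a : Fin n → ℝ) (b : ℝ) :
    P.expect (fun x => ∑ i, a i * φ i x + b) = ∑ i, a i * P.expect (φ i) + b := by
  have h : (⟨_, BoundedMeasurable.affine hφ a b⟩ : boundedMeasurableSubmodule Ω) =
      ∑ i, a i • (⟨φ i, hφ i⟩ : boundedMeasurableSubmodule Ω) + ⟨_, BoundedMeasurable.const b⟩ := by
    ext x
    simp
  have h2 := congrArg P.expectLinear h
  rw [map_add, map_sum] at h2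
  simp only [map_smul] at h2
  exact h2.trans (congrArg₂ _ rfl (P.expect_const b))

/-- A positive linear functional which agrees with `P` on indicators is the expectation. -/
theorem expect_eq_of_indicator (Λ : boundedMeasurableSubmodule Ω →ₗ[ℝ] ℝ)
    (hΛ : ∀ g, (∀ x, 0 ≤ g.1 x) → 0 ≤ Λ g)
    (hm : ∀ E (_ : MeasurableSet E) (h : E.indicator (fun _ => (1 : ℝ)) ∈ BoundedMeasurable Ω),
      Λ ⟨_, h⟩ = P.mass E) {h : Ω → ℝ} (hh : h ∈ BoundedMeasurable Ω) :
    P.expect h = Λ ⟨h, hh⟩ := by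
  have hone : Λ ⟨_, BoundedMeasurable.const 1⟩ = 1 := by
    have := hm Set.univ MeasurableSet.univ
    simp only [Set.indicator_univ, P.mass_univ] at this
    exact this (BoundedMeasurable.const 1)
  have key : ∀ ε > 0, |P.expect h - Λ ⟨h, hh⟩| ≤ 0 + ε := by
    intro ε hε
    obtain ⟨g, hg⟩ := BoundedMeasurable.exists_simpleFunc hh hε
    have h1 := P.expect_mem_Icc hh hg
    have h2 := map_simpleFunc_bounds hh Λ hΛ hone g hg
    rw [map_simpleFunc_eq_sum Λ P.mass hm g] at h2
    change P.simpleExpect g ≤ _ ∧ _ ≤ P.simpleExpect g + ε at h2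
    rw [abs_le]
    constructor <;> linarith
  exact sub_eq_zero.1 (abs_nonpos_iff.1 (le_of_forall_pos_le_add key))

theorem expect_indicator {E : Set Ω} (hE : MeasurableSet E) :
    P.expect (E.indicator fun _ => (1 : ℝ)) = P.mass E := by
  rw [← P.simpleExpect_indicator hE, ← P.expect_simpleFunc]
  congr 1

end FinAddProb

/-! ### Finitely additive probabilities as positive functionals, and the countably additive case -/

section Representation

variable {Ω : Type*} [MeasurableSpace Ω]

theorem BoundedMeasurable.indicator {E : Set Ω} (hE : MeasurableSet E) :
    E.indicator (fun _ => (1 : ℝ)) ∈ BoundedMeasurable Ω :=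
  ⟨measurable_const.indicator hE, 1, fun x => by
    by_cases hx : x ∈ E <;> simp [hx]⟩

/-- Every positive normalised linear functional on the bounded measurable functions is the
expectation of a finitely additive probability. -/
theorem exists_finAddProb_expect_eq (Λ : boundedMeasurableSubmodule Ω →ₗ[ℝ] ℝ)
    (hΛ : ∀ g, (∀ x, 0 ≤ g.1 x) → 0 ≤ Λ g) (hone : Λ ⟨_, BoundedMeasurable.const 1⟩ = 1) :
    ∃ P : FinAddProb Ω, ∀ h (hh : h ∈ BoundedMeasurable Ω), P.expect h = Λ ⟨h, hh⟩ := by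
  classical
  have hm : ∀ E, MeasurableSet E →
      ∀ h : E.indicator (fun _ => (1 : ℝ)) ∈ BoundedMeasurable Ω,
      (if hE : MeasurableSet E then Λ ⟨_, BoundedMeasurable.indicator hE⟩ else 0) = Λ ⟨_, h⟩ :=
    fun E hE _ => by rw [dif_pos hE]
  let P : FinAddProb Ω :=
    { mass := fun E => if hE : MeasurableSet E then Λ ⟨_, BoundedMeasurable.indicator hE⟩ else 0
      mass_nonneg := fun E hE => by
        rw [hm E hE (BoundedMeasurable.indicator hE)]
        exact hΛ _ fun x => Set.indicator_nonneg (fun _ _ => zero_le_one) x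
      mass_union := fun E F hE hF hd => by
        rw [hm _ (hE.union hF) (BoundedMeasurable.indicator (hE.union hF)),
          hm E hE (BoundedMeasurable.indicator hE), hm F hF (BoundedMeasurable.indicator hF),
          ← map_add]
        congr 1
        ext1
        exact Set.indicator_union_of_disjoint hd _
      mass_univ := by
        refine (hm _ MeasurableSet.univ (BoundedMeasurable.indicator MeasurableSet.univ)).trans
          (Eq.trans (congrArg Λ ?_) hone)
        ext1
        exact Set.indicator_univ _ }
  exact ⟨P, fun h hh => P.expect_eq_of_indicator Λ hΛ (fun E hE h => (hm E hE h).symm) hh⟩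

namespace FinAddProb

variable (P : FinAddProb Ω)

theorem toMeasure_apply (hP : P.IsCountablyAdditive) {E : Set Ω} (hE : MeasurableSet E) :
    P.toMeasure hP E = ENNReal.ofReal (P.mass E) :=
  Measure.ofMeasurable_apply E hE

theorem isProbabilityMeasure_toMeasure (hP : P.IsCountablyAdditive) :
    IsProbabilityMeasure (P.toMeasure hP) :=
  ⟨by rw [P.toMeasure_apply hP MeasurableSet.univ, P.mass_univ, ENNReal.ofReal_one]⟩

theorem AbsCont.absolutelyContinuous {P : FinAddProb Ω} {Q : Measure Ω} (h : P.AbsCont Q)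
    (hP : P.IsCountablyAdditive) : P.toMeasure hP ≪ Q :=
  Measure.AbsolutelyContinuous.mk fun E hE h0 => by
    rw [P.toMeasure_apply hP hE, h E hE h0, ENNReal.ofReal_zero]

theorem _root_.FGAN.BoundedMeasurable.integrable {h : Ω → ℝ} (hh : h ∈ BoundedMeasurable Ω)
    (μ : Measure Ω) [IsFiniteMeasure μ] : Integrable h μ :=
  let ⟨hm, C, hC⟩ := hh
  Integrable.of_bound hm.aestronglyMeasurable C (ae_of_all _ hC)

theorem expect_eq_integral (hP : P.IsCountablyAdditive) {h : Ω → ℝ}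
    (hh : h ∈ BoundedMeasurable Ω) : P.expect h = ∫ x, h x ∂(P.toMeasure hP) := by
  have := P.isProbabilityMeasure_toMeasure hP
  let Λ : boundedMeasurableSubmodule Ω →ₗ[ℝ] ℝ :=
    { toFun := fun h => ∫ x, h.1 x ∂(P.toMeasure hP)
      map_add' := fun g h => integral_add (BoundedMeasurable.integrable g.2 _)
        (BoundedMeasurable.integrable h.2 _)
      map_smul' := fun c h => integral_const_mul c _ }
  refine P.expect_eq_of_indicator Λ (fun g hg => integral_nonneg hg) (fun E hE _ => ?_) hh
  change ∫ x, E.indicator (fun _ => (1 : ℝ)) x ∂(P.toMeasure hP) = _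
  rw [integral_indicator hE]
  simp [Measure.real, P.toMeasure_apply hP hE, ENNReal.toReal_ofReal (P.mass_nonneg E hE)]

end FinAddProb

end Representation

/-! ### Integrals of extended-real-valued functions -/

section ExtendedIntegral

variable {Ω : Type*} [MeasurableSpace Ω] {Q : Measure Ω}

theorem eintegral_mono_ae {g h : Ω → EReal} (hgh : ∀ᵐ x ∂Q, g x ≤ h x) :
    eintegral Q g ≤ eintegral Q h := by
  refine EReal.sub_le_sub ?_ ?_
  · exact EReal.coe_ennreal_le_coe_ennreal_iff.2 <| lintegral_mono_ae <| by
      filter_upwards [hgh] with x hx using EReal.toENNReal_le_toENNReal hx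
  · exact EReal.coe_ennreal_le_coe_ennreal_iff.2 <| lintegral_mono_ae <| by
      filter_upwards [hgh] with x hx using
        EReal.toENNReal_le_toENNReal (EReal.neg_le_neg_iff.2 hx)

theorem eintegral_coe {v : Ω → ℝ} (hv : Integrable v Q) :
    eintegral Q (fun x => (v x : EReal)) = ((∫ x, v x ∂Q : ℝ) : EReal) := by
  have h1 : ∫⁻ x, ENNReal.ofReal (v x) ∂Q ≠ ∞ := hv.lintegral_lt_top.ne
  have h2 : ∫⁻ x, ENNReal.ofReal (-v x) ∂Q ≠ ∞ := hv.neg.lintegral_lt_top.ne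
  rw [integral_eq_lintegral_pos_part_sub_lintegral_neg_part hv, EReal.coe_sub]
  simp only [eintegral, ← EReal.coe_neg, EReal.real_coe_toENNReal]
  rw [← EReal.toReal_coe_ennreal, ← EReal.toReal_coe_ennreal, EReal.coe_toReal, EReal.coe_toReal] <;>
    simp [h1, h2]

/-- The integrable minorant makes the negative part finite, so ⊤ is the only value that prevents g
from being integrable; apart from it, everything reduces to Bochner integrals. -/
theorem eintegral_eq_integral_toReal {g : Ω → EReal} (hg : Measurable g) {u : Ω → ℝ}
    (hu : Integrable u Q) (hug : ∀ᵐ x ∂Q, (u x : EReal) ≤ g x) (h : eintegral Q g ≠ ⊤) :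
    Integrable (fun x => (g x).toReal) Q ∧ (∀ᵐ x ∂Q, g x = ((g x).toReal : EReal)) ∧
      eintegral Q g = ((∫ x, (g x).toReal ∂Q : ℝ) : EReal) := by
  have hneg : ∫⁻ x, (-g x).toENNReal ∂Q ≠ ∞ := by
    refine ne_top_of_le_ne_top hu.neg.lintegral_lt_top.ne (lintegral_mono_ae ?_)
    filter_upwards [hug] with x hx
    have := EReal.toENNReal_le_toENNReal (EReal.neg_le_neg_iff.2 hx)
    rwa [← EReal.coe_neg, EReal.real_coe_toENNReal] at this
  have hpos : ∫⁻ x, (g x).toENNReal ∂Q ≠ ∞ := by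
    intro htop
    refine h ?_
    rw [eintegral, htop, EReal.coe_ennreal_top, EReal.top_sub]
    rwa [Ne, EReal.coe_ennreal_eq_top_iff]
  have hfin : ∀ᵐ x ∂Q, g x = ((g x).toReal : EReal) := by
    filter_upwards [ae_lt_top (measurable_ereal_toENNReal.comp hg) hpos, hug] with x hx hx'
    refine (EReal.coe_toReal ?_ ?_).symm
    · exact EReal.toENNReal_ne_top_iff.1 hx.ne
    · exact (lt_of_lt_of_le (EReal.bot_lt_coe _) hx').ne'
  have hint : Integrable (fun x => (g x).toReal) Q := by
    refine ⟨(measurable_ereal_toReal.comp hg).aestronglyMeasurable, ?_⟩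
    refine lt_of_le_of_lt (lintegral_mono_ae (g := fun x => (g x).toENNReal + (-g x).toENNReal) ?_) ?_
    · filter_upwards [hfin] with x hx
      rw [hx, ← EReal.coe_neg, EReal.real_coe_toENNReal, EReal.real_coe_toENNReal, EReal.toReal_coe,
        ← ofReal_norm, Real.norm_eq_abs]
      rcases le_total 0 (g x).toReal with h0 | h0
      · rw [abs_of_nonneg h0]
        exact le_self_add
      · rw [abs_of_nonpos h0]
        exact le_add_self
    · rw [lintegral_add_left (f := fun x => (g x).toENNReal) (measurable_ereal_toENNReal.comp hg)]
      exact ENNReal.add_lt_top.2 ⟨hpos.lt_top, hneg.lt_top⟩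
  refine ⟨hint, hfin, ?_⟩
  rw [← eintegral_coe hint]
  exact le_antisymm (eintegral_mono_ae (hfin.mono fun _ hx => hx.le))
    (eintegral_mono_ae (hfin.mono fun _ hx => hx.ge))

end ExtendedIntegral

/-! ### The convex conjugate and biconjugation on the line -/

section Conjugate

variable {f : ℝ → EReal} (hf : IsDivergenceFunction f)

include hf

/-- Testing against real points (x, r) of the epigraph removes the value ⊤ and turns conjugate
bounds into real inequalities. -/
theorem conj_le_iff {s t : ℝ} :
    conj f s ≤ t ↔ ∀ x r : ℝ, f x ≤ r → x * s - t ≤ r := by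
  rw [conj, iSup_le_iff]
  refine forall_congr' fun x => ⟨fun h r hr => ?_, fun h => ?_⟩
  · have h1 : ((x * s - r : ℝ) : EReal) ≤ t := by
      rw [EReal.coe_sub]
      exact (EReal.sub_le_sub le_rfl hr).trans h
    linarith [EReal.coe_le_coe_iff.1 h1]
  · rcases eq_or_ne (f x) ⊤ with htop | htop
    · rw [htop, EReal.sub_top]
      exact bot_le
    · have e := EReal.coe_toReal htop (hf.ne_bot x)
      have h1 := h (f x).toReal e.ge
      rw [← e, ← EReal.coe_sub, EReal.coe_le_coe_iff]
      linarith

/-- Negative x contribute nothing since f = ⊤ there. This monotonicity is what later makes the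
separating functional positive. -/
theorem conj_mono : Monotone (conj f) := by
  intro s s' hss
  refine iSup_mono fun x => ?_
  rcases lt_or_ge x 0 with hx | hx
  · rw [hf.top_of_neg x hx, EReal.sub_top]
    exact bot_le
  · exact EReal.sub_le_sub (EReal.coe_le_coe_iff.2 (mul_le_mul_of_nonneg_left hss hx)) le_rfl

theorem le_conj (s : ℝ) : (s : EReal) ≤ conj f s := by
  refine le_trans ?_ (le_iSup _ 1)
  rw [hf.map_one, one_mul, sub_zero]

theorem conj_ne_bot (s : ℝ) : conj f s ≠ ⊥ :=
  (lt_of_lt_of_le (EReal.bot_lt_coe s) (le_conj hf s)).ne'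

theorem conj_convex {s s' t t' a b : ℝ} (hs : conj f s ≤ t) (hs' : conj f s' ≤ t') (ha : 0 ≤ a)
    (hb : 0 ≤ b) (hab : a + b = 1) :
    conj f (a * s + b * s') ≤ ((a * t + b * t' : ℝ) : EReal) := by
  rw [conj_le_iff hf] at *
  intro x r hr
  have h1 := mul_le_mul_of_nonneg_left (hs x r hr) ha
  have h2 := mul_le_mul_of_nonneg_left (hs' x r hr) hb
  calc x * (a * s + b * s') - (a * t + b * t')
      = a * (x * s - t) + b * (x * s' - t') := by ring
    _ ≤ a * r + b * r := add_le_add h1 h2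
    _ = r := by rw [← add_mul, hab, one_mul]

theorem convex_epigraph : Convex ℝ {p : ℝ × ℝ | f p.1 ≤ p.2} := by
  rw [convex_iff_forall_pos]
  intro p hp q hq a b ha hb hab
  refine (hf.convex p.1 q.1 a b ha hb hab).trans ?_
  have e : (((a • p + b • q).2 : ℝ) : EReal) = (a : EReal) * p.2 + (b : EReal) * q.2 := by
    simp
  rw [e]
  exact add_le_add (mul_le_mul_of_nonneg_left hp (EReal.coe_nonneg.2 ha.le))
    (mul_le_mul_of_nonneg_left hq (EReal.coe_nonneg.2 hb.le))

theorem isClosed_epigraph : IsClosed {p : ℝ × ℝ | f p.1 ≤ p.2} :=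
  hf.lsc.isClosed_epigraph.preimage
    (continuous_fst.prodMk (continuous_coe_real_ereal.comp continuous_snd))

/-- A point below the graph is separated from the epigraph by a line. -/
theorem exists_separating {x y : ℝ} (hxy : (y : EReal) < f x) :
    ∃ α β u : ℝ, 0 ≤ β ∧ α * x + β * y < u ∧ ∀ z r : ℝ, f z ≤ r → u < α * z + β * r := by
  obtain ⟨g, u, h1, h2⟩ := geometric_hahn_banach_point_closed (convex_epigraph hf)
    (isClosed_epigraph hf) (x := (x, y)) (fun h => (lt_of_lt_of_le hxy h).false)
  have e : ∀ z r : ℝ, g (z, r) = g (1, 0) * z + g (0, 1) * r := fun z r => by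
    have : ((z, r) : ℝ × ℝ) = z • (1, 0) + r • (0, 1) := by simp
    rw [this, map_add, map_smul, map_smul, smul_eq_mul, smul_eq_mul]
    ring
  have h3 : ∀ z r : ℝ, f z ≤ r → u < g (1, 0) * z + g (0, 1) * r := fun z r h => by
    rw [← e]
    exact h2 (z, r) h
  refine ⟨g (1, 0), g (0, 1), u, ?_, by rwa [← e], h3⟩
  by_contra! hneg
  -- The epigraph contains the ray above (1, 0). If the vertical coefficient were negative, the
  -- chosen height on this ray would give exactly u, against strict separation.
  have hr : ∀ r : ℝ, 0 ≤ r → u < g (1, 0) * 1 + g (0, 1) * r := fun r hr => h3 1 r (by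
    rw [hf.map_one]
    exact EReal.coe_nonneg.2 hr)
  have h4 := hr ((g (1, 0) - u) / -g (0, 1)) (by
    have := hr 0 le_rfl
    refine div_nonneg ?_ ?_ <;> linarith)
  have h5 : g (0, 1) * ((g (1, 0) - u) / -g (0, 1)) = -(g (1, 0) - u) := by
    rw [div_neg, mul_neg, mul_div_cancel₀ _ hneg.ne]
  rw [h5] at h4
  linarith

theorem conj_le_of_separating {α β u : ℝ} (hβ : 0 < β)
    (h : ∀ z r : ℝ, f z ≤ r → u < α * z + β * r) : conj f (-α / β) ≤ ((-u / β : ℝ) : EReal) := by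
  rw [conj_le_iff hf]
  intro z r hr
  have := h z r hr
  have e : z * (-α / β) - -u / β = (u - α * z) / β := by ring
  rw [e, div_le_iff₀ hβ]
  linarith

/-- Over x = 1 the separating line has (1, -1) and (1, 0) on opposite sides, hence is not vertical.
-/
theorem exists_conj_le : ∃ s t : ℝ, conj f s ≤ t := by
  obtain ⟨α, β, u, hβ, h1, h2⟩ := exists_separating hf (x := 1) (y := -1) (by
    rw [hf.map_one]
    exact_mod_cast neg_one_lt_zero)
  have h3 := h2 1 0 hf.map_one.le
  exact ⟨_, _, conj_le_of_separating hf (by linarith) h2⟩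

/-- Biconjugation for a convex lower semicontinuous function on the line. -/
theorem exists_conj_le_lt {x y : ℝ} (hxy : (y : EReal) < f x) :
    ∃ s t : ℝ, conj f s ≤ t ∧ y < x * s - t := by
  obtain ⟨α, β, u, hβ, h1, h2⟩ := exists_separating hf hxy
  rcases hβ.eq_or_lt with rfl | hβ
  · obtain ⟨s, t, hst⟩ := exists_conj_le hf
    simp only [zero_mul, add_zero] at h1 h2
    obtain ⟨k, hk⟩ := exists_nat_gt ((y - (x * s - t)) / (u - α * x))
    rw [div_lt_iff₀ (by linarith)] at hk
    refine ⟨s - k * α, t - k * u, ?_, by linarith⟩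
    rw [conj_le_iff hf] at hst ⊢
    intro z r hr
    have h3 := hst z r hr
    have h4 := mul_le_mul_of_nonneg_left (h2 z r hr).le (Nat.cast_nonneg (α := ℝ) k)
    linarith
  · refine ⟨_, _, conj_le_of_separating hf hβ h2, ?_⟩
    have e : x * (-α / β) - -u / β = (u - α * x) / β := by ring
    rw [e, lt_div_iff₀ hβ]
    linarith

/-- Lowering the slope slightly keeps its conjugate bound, by monotonicity of f^*; so rational
slopes suffice, and there are countably many. -/
theorem exists_rat_conj_le_lt {x y : ℝ} (hxy : (y : EReal) < f x) :
    ∃ q : ℚ, conj f q ≠ ⊤ ∧ y < x * q - (conj f q).toReal := by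
  obtain ⟨s, t, hst, hy⟩ := exists_conj_le_lt hf hxy
  have hcont : ContinuousAt (fun s' : ℝ => x * s' - t) s := by fun_prop
  obtain ⟨q, hq, hqs⟩ : ∃ q : ℚ, y < x * q - t ∧ (q : ℝ) < s := by
    have h1 : ∀ᶠ s' in 𝓝 s, y < x * s' - t := hcont.eventually (lt_mem_nhds hy)
    obtain ⟨l, hl, hls⟩ := exists_Ioc_subset_of_mem_nhds h1 (exists_lt s)
    obtain ⟨q, hlq, hqs⟩ := exists_rat_btwn hl
    exact ⟨q, hls ⟨hlq, hqs.le⟩, hqs⟩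
  have hle : conj f q ≤ t := (conj_mono hf hqs.le).trans hst
  have htop : conj f q ≠ ⊤ := (lt_of_le_of_lt hle (EReal.coe_lt_top t)).ne
  refine ⟨q, htop, ?_⟩
  rw [← EReal.coe_toReal htop (conj_ne_bot hf q), EReal.coe_le_coe_iff] at hle
  linarith

end Conjugate

/-! ### Convexity and monotonicity of h ↦ E_Q[f^*(h)] -/

section ConjugateIntegral

variable {Ω : Type*} [MeasurableSpace Ω] {Q : Measure Ω} [IsProbabilityMeasure Q]
  {f : ℝ → EReal} (hf : IsDivergenceFunction f)

include hf

omit [IsProbabilityMeasure Q] in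
theorem eintegral_conj_mono {g h : Ω → ℝ} (hgh : ∀ᵐ x ∂Q, g x ≤ h x) :
    eintegral Q (fun x => conj f (g x)) ≤ eintegral Q (fun x => conj f (h x)) :=
  eintegral_mono_ae (hgh.mono fun _ hx => conj_mono hf hx)

omit hf in
theorem eintegral_conj_const {s t : ℝ} (h : conj f s ≤ t) :
    eintegral Q (fun _ => conj f s) ≤ t := by
  refine (eintegral_mono_ae (ae_of_all _ fun _ => h)).trans ?_
  rw [eintegral_coe (integrable_const t)]
  simp

theorem eintegral_conj_eq {h : Ω → ℝ} (hh : h ∈ BoundedMeasurable Ω)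
    (hne : eintegral Q (fun x => conj f (h x)) ≠ ⊤) :
    Integrable (fun x => (conj f (h x)).toReal) Q ∧
      (∀ᵐ x ∂Q, conj f (h x) = ((conj f (h x)).toReal : EReal)) ∧
      eintegral Q (fun x => conj f (h x)) = ((∫ x, (conj f (h x)).toReal ∂Q : ℝ) : EReal) :=
  eintegral_eq_integral_toReal ((conj_mono hf).measurable.comp hh.1)
    (BoundedMeasurable.integrable hh Q) (ae_of_all _ fun x => le_conj hf (h x)) hne

theorem eintegral_conj_convex {g h : Ω → ℝ} (hg : g ∈ BoundedMeasurable Ω)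
    (hh : h ∈ BoundedMeasurable Ω) {r s a b : ℝ}
    (hr : eintegral Q (fun x => conj f (g x)) ≤ r) (hs : eintegral Q (fun x => conj f (h x)) ≤ s)
    (ha : 0 ≤ a) (hb : 0 ≤ b) (hab : a + b = 1) :
    eintegral Q (fun x => conj f (a * g x + b * h x)) ≤ ((a * r + b * s : ℝ) : EReal) := by
  obtain ⟨ig, eg, vg⟩ := eintegral_conj_eq hf hg (lt_of_le_of_lt hr (EReal.coe_lt_top r)).ne
  obtain ⟨ih, eh, vh⟩ := eintegral_conj_eq hf hh (lt_of_le_of_lt hs (EReal.coe_lt_top s)).ne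
  rw [vg, EReal.coe_le_coe_iff] at hr
  rw [vh, EReal.coe_le_coe_iff] at hs
  refine (eintegral_mono_ae (h := fun x =>
    ((a * (conj f (g x)).toReal + b * (conj f (h x)).toReal : ℝ) : EReal)) ?_).trans ?_
  · filter_upwards [eg, eh] with x hx hx' using conj_convex hf hx.le hx'.le ha hb hab
  · have hi : Integrable (fun x => a * (conj f (g x)).toReal + b * (conj f (h x)).toReal) Q :=
      (ig.const_mul a).add (ih.const_mul b)
    rw [eintegral_coe hi, EReal.coe_le_coe_iff,
      integral_add (ig.const_mul a) (ih.const_mul b), integral_const_mul, integral_const_mul]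
    exact add_le_add (mul_le_mul_of_nonneg_left hr ha) (mul_le_mul_of_nonneg_left hs hb)

end ConjugateIntegral

/-! ### The variational formula for the extended divergence -/

section Variational

variable {f : ℝ → EReal} (hf : IsDivergenceFunction f)

include hf

theorem affine_le_of_conj_le {s t : ℝ} (h : conj f s ≤ t) (x : ℝ) :
    ((x * s - t : ℝ) : EReal) ≤ f x := by
  rcases eq_or_ne (f x) ⊤ with htop | htop
  · rw [htop]
    exact le_top
  · have e := EReal.coe_toReal htop (hf.ne_bot x)
    rw [← e, EReal.coe_le_coe_iff]
    exact (conj_le_iff hf).1 h x _ e.ge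

/-- Increasing approximations of `f` from below by maxima of finitely many affine minorants,
through the slope of a maximal one. -/
theorem exists_slopes : ∃ A : ℕ → ℝ → ℝ, (∀ k, Measurable (A k)) ∧
    (∀ k, ∃ C : ℝ, ∀ x, |A k x| ≤ C ∧ conj f (A k x) ≤ C) ∧
    (∀ x, Monotone fun k => x * A k x - (conj f (A k x)).toReal) ∧
    ∀ x y : ℝ, (y : EReal) < f x → ∃ k, y < x * A k x - (conj f (A k x)).toReal := by
  let S : Set ℝ := {s | ∃ q : ℚ, (q : ℝ) = s ∧ conj f s ≠ ⊤}
  have hS : S.Countable :=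
    (Set.countable_range ((↑) : ℚ → ℝ)).mono <| by
      rintro s ⟨q, hq, -⟩
      exact ⟨q, hq⟩
  have hne : S.Nonempty := by
    obtain ⟨q, hq, -⟩ := exists_rat_conj_le_lt hf (x := 1) (y := -1) (by
      rw [hf.map_one]
      exact_mod_cast neg_one_lt_zero)
    exact ⟨q, q, rfl, hq⟩
  obtain ⟨c, hc⟩ := hS.exists_eq_range hne
  have hctop : ∀ i, conj f (c i) ≠ ⊤ := fun i => by
    have : c i ∈ S := hc ▸ ⟨i, rfl⟩
    exact this.choose_spec.2
  let val : ℝ → ℝ → ℝ := fun s x => x * s - (conj f s).toReal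
  -- `A k x` is a slope among c 0, ..., c k whose affine minorant is largest at x. It takes finitely
  -- many values, so its composition with a density is an admissible bounded test function.
  let A : ℕ → ℝ → ℝ := fun k => Nat.rec (fun _ => c 0)
    (fun k Ak x => if val (Ak x) x < val (c (k + 1)) x then c (k + 1) else Ak x) k
  have hA : ∀ k x, A (k + 1) x =
      if val (A k x) x < val (c (k + 1)) x then c (k + 1) else A k x := fun k x => rfl
  have hconj : Measurable (conj f) := (conj_mono hf).measurable
  have hmono : ∀ k x, val (A k x) x ≤ val (A (k + 1) x) x := fun k x => by
    rw [hA]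
    split_ifs with h
    · exact h.le
    · exact le_rfl
  have hci : ∀ i x, val (c i) x ≤ val (A i x) x := by
    rintro (_ | i) x
    · exact le_rfl
    · rw [hA]
      split_ifs with h
      · exact le_rfl
      · exact not_lt.1 h
  refine ⟨A, fun k => ?_, fun k => ?_, fun x => monotone_nat_of_le_succ fun k => hmono k x,
    fun x y hxy => ?_⟩
  · induction k with
    | zero => exact measurable_const
    | succ k ih =>
      refine Measurable.ite (measurableSet_lt ?_ ?_) measurable_const ih
      · exact (measurable_id.mul ih).sub (measurable_ereal_toReal.comp (hconj.comp ih))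
      · exact (measurable_id.mul measurable_const).sub measurable_const
  · have hc' : ∀ i, ∃ C : ℝ, |c i| ≤ C ∧ conj f (c i) ≤ C := fun i =>
      ⟨max |c i| (conj f (c i)).toReal, le_max_left _ _, by
        conv_lhs => rw [← EReal.coe_toReal (hctop i) (conj_ne_bot hf _)]
        exact EReal.coe_le_coe_iff.2 (le_max_right _ _)⟩
    induction k with
    | zero => exact (hc' 0).imp fun C hC _ => hC
    | succ k ih =>
      obtain ⟨C, hC⟩ := ih
      obtain ⟨D, hD⟩ := hc' (k + 1)
      refine ⟨max C D, fun x => ?_⟩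
      rw [hA]
      split_ifs
      · exact ⟨hD.1.trans (le_max_right _ _),
          hD.2.trans (EReal.coe_le_coe_iff.2 (le_max_right _ _))⟩
      · exact ⟨(hC x).1.trans (le_max_left _ _),
          (hC x).2.trans (EReal.coe_le_coe_iff.2 (le_max_left _ _))⟩
  · obtain ⟨q, hq, hy⟩ := exists_rat_conj_le_lt hf hxy
    have : (q : ℝ) ∈ S := ⟨q, rfl, hq⟩
    rw [hc] at this
    obtain ⟨i, hi⟩ := this
    rw [← hi] at hy
    exact ⟨i, hy.trans_le (hci i x)⟩

variable {Ω : Type*} [MeasurableSpace Ω] {Q : Measure Ω} [IsProbabilityMeasure Q]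
  {P : FinAddProb Ω}

/-- Weak duality for measures. -/
theorem expect_sub_eintegral_conj_le_fDiv (hP : P.IsCountablyAdditive) (hPQ : P.AbsCont Q)
    {h : Ω → ℝ} (hh : h ∈ BoundedMeasurable Ω) :
    ((P.expect h : ℝ) : EReal) - eintegral Q (fun x => conj f (h x)) ≤
      fDiv f (P.toMeasure hP) Q := by
  have := P.isProbabilityMeasure_toMeasure hP
  have hac := hPQ.absolutelyContinuous hP
  set μ := P.toMeasure hP
  rcases eq_or_ne (eintegral Q (fun x => conj f (h x))) ⊤ with h1 | h1
  · rw [h1, EReal.sub_top]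
    exact bot_le
  rcases eq_or_ne (fDiv f μ Q) ⊤ with h2 | h2
  · rw [h2]
    exact le_top
  obtain ⟨i1, e1, v1⟩ := eintegral_conj_eq hf hh h1
  obtain ⟨s, t, hst⟩ := exists_conj_le hf
  have hρ : Integrable (fun x => (μ.rnDeriv Q x).toReal) Q := Measure.integrable_toReal_rnDeriv
  obtain ⟨i2, e2, v2⟩ := eintegral_eq_integral_toReal (Q := Q)
    (g := fun x => f (μ.rnDeriv Q x).toReal)
    (hf.lsc.measurable.comp (Measure.measurable_rnDeriv μ Q).ennreal_toReal)
    ((hρ.mul_const s).sub (integrable_const t))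
    (ae_of_all _ fun x => affine_le_of_conj_le hf hst _) h2
  rw [fDiv, v1, v2, ← EReal.coe_sub, EReal.coe_le_coe_iff, P.expect_eq_integral hP hh,
    ← integral_toReal_rnDeriv_mul hac, sub_le_iff_le_add, ← integral_add i2 i1]
  have i3 : Integrable (fun x => (μ.rnDeriv Q x).toReal * h x) Q :=
    (integrable_rnDeriv_smul_iff hac).2 (BoundedMeasurable.integrable hh μ)
  refine integral_mono_ae i3 (i2.add i1) ?_
  filter_upwards [e1, e2] with x hx1 hx2
  have := (conj_le_iff hf).1 hx1.le _ _ hx2.le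
  linarith

theorem fDiv_le_of_forall (hP : P.IsCountablyAdditive) (hPQ : P.AbsCont Q) {M : ℝ}
    (hM : ∀ h ∈ BoundedMeasurable Ω,
      ((P.expect h : ℝ) : EReal) - eintegral Q (fun x => conj f (h x)) ≤ M) :
    fDiv f (P.toMeasure hP) Q ≤ M := by
  have := P.isProbabilityMeasure_toMeasure hP
  have hac := hPQ.absolutelyContinuous hP
  set μ := P.toMeasure hP
  obtain ⟨A, hAm, hAb, hAmono, hA⟩ := exists_slopes hf
  let ρ : Ω → ℝ := fun x => (μ.rnDeriv Q x).toReal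
  have hρ : Measurable ρ := (Measure.measurable_rnDeriv μ Q).ennreal_toReal
  -- The hypothesis applied to the test function `A k ∘ ρ` bounds ∫ `G k` by M, while `G k`
  -- increases to f(ρ).
  let G : ℕ → Ω → ℝ := fun k x => ρ x * A k (ρ x) - (conj f (A k (ρ x))).toReal
  have hG : ∀ k, Integrable (G k) Q ∧ ∫ x, G k x ∂Q ≤ M := fun k => by
    obtain ⟨C, hC⟩ := hAb k
    have hB : (fun x => A k (ρ x)) ∈ BoundedMeasurable Ω :=
      ⟨(hAm k).comp hρ, C, fun x => (hC _).1⟩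
    have hle : eintegral Q (fun x => conj f (A k (ρ x))) ≤ C := by
      refine (eintegral_mono_ae (ae_of_all _ fun x => (hC (ρ x)).2)).trans ?_
      rw [eintegral_coe (integrable_const C)]
      simp
    obtain ⟨i1, e1, v1⟩ := eintegral_conj_eq hf hB (lt_of_le_of_lt hle (EReal.coe_lt_top C)).ne
    have i2 : Integrable (fun x => ρ x * A k (ρ x)) Q :=
      (integrable_rnDeriv_smul_iff hac).2 (BoundedMeasurable.integrable hB μ)
    have h1 := hM _ hB
    rw [v1, ← EReal.coe_sub, EReal.coe_le_coe_iff, P.expect_eq_integral hP hB,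
      ← integral_toReal_rnDeriv_mul hac, ← integral_sub i2 i1] at h1
    exact ⟨i2.sub i1, h1⟩
  have hGmono : ∀ x, Monotone fun k => G k x := fun x => hAmono (ρ x)
  -- Subtracting `G 0` makes the increasing sequence nonnegative, as monotone convergence for the
  -- lower integral requires.
  let w : Ω → ℝ≥0∞ := fun x => ⨆ k, ENNReal.ofReal (G k x - G 0 x)
  have hGm : ∀ k, Measurable fun x => ENNReal.ofReal (G k x - G 0 x) := fun k => by
    have : ∀ k, Measurable (G k) := fun k => (hρ.mul ((hAm k).comp hρ)).sub
      (measurable_ereal_toReal.comp ((conj_mono hf).measurable.comp ((hAm k).comp hρ)))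
    exact ((this k).sub (this 0)).ennreal_ofReal
  have hw : ∫⁻ x, w x ∂Q ≤ ENNReal.ofReal (M - ∫ x, G 0 x ∂Q) := by
    rw [lintegral_iSup hGm fun i j hij x => ENNReal.ofReal_le_ofReal
      (sub_le_sub_right (hGmono x hij) _)]
    refine iSup_le fun k => ?_
    have hi : Integrable (fun x => G k x - G 0 x) Q := (hG k).1.sub (hG 0).1
    rw [← ofReal_integral_eq_lintegral_ofReal hi
      (ae_of_all _ fun x => sub_nonneg.2 (hGmono x (Nat.zero_le k)))]
    refine ENNReal.ofReal_le_ofReal ?_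
    rw [integral_sub (hG k).1 (hG 0).1]
    linarith [(hG k).2]
  have hwm : Measurable w := Measurable.iSup hGm
  have hwtop : ∫⁻ x, w x ∂Q ≠ ∞ := ne_top_of_le_ne_top ENNReal.ofReal_ne_top hw
  have hwi := integrable_toReal_of_lintegral_ne_top hwm.aemeasurable hwtop
  have hwfin := ae_lt_top hwm hwtop
  have hv : Integrable (fun x => G 0 x + (w x).toReal) Q := (hG 0).1.add hwi
  refine (eintegral_mono_ae (h := fun x => ((G 0 x + (w x).toReal : ℝ) : EReal)) ?_).trans ?_
  · filter_upwards [hwfin] with x hx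
    rw [← EReal.ge_of_forall_gt_iff_ge]
    intro y hy
    obtain ⟨k, hk⟩ := hA _ y hy
    have h1 : ENNReal.ofReal (G k x - G 0 x) ≤ w x :=
      le_iSup (fun k => ENNReal.ofReal (G k x - G 0 x)) k
    have h2 := ENNReal.toReal_mono hx.ne h1
    rw [ENNReal.toReal_ofReal (sub_nonneg.2 (hGmono x (Nat.zero_le k)))] at h2
    have h3 : y < G k x := hk
    rw [EReal.coe_le_coe_iff]
    linarith
  · rw [eintegral_coe hv, EReal.coe_le_coe_iff, integral_add (hG 0).1 hwi,
      integral_toReal hwm.aemeasurable hwfin]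
    have := ENNReal.toReal_mono ENNReal.ofReal_ne_top hw
    rw [ENNReal.toReal_ofReal (sub_nonneg.2 (hG 0).2)] at this
    linarith

/-- The variational formula for the extended divergence holds for all finitely additive
probabilities. -/
theorem fDivBar_eq_iSup (P : FinAddProb Ω) : fDivBar f P Q = ⨆ h ∈ BoundedMeasurable Ω,
    ((P.expect h : ℝ) : EReal) - eintegral Q (fun x => conj f (h x)) := by
  rw [fDivBar]
  split_ifs with h
  · refine le_antisymm ?_ (iSup₂_le fun g hg => expect_sub_eintegral_conj_le_fDiv hf h.1 h.2 hg)
    rw [← EReal.le_of_forall_lt_iff_le]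
    intro M hM
    exact fDiv_le_of_forall hf h.1 h.2 fun g hg => le_trans
      (le_iSup₂ (f := fun g (_ : g ∈ BoundedMeasurable Ω) =>
        ((P.expect g : ℝ) : EReal) - eintegral Q (fun x => conj f (g x))) g hg) hM.le
  · rfl

/-- A test function raised on a Q-null set of positive P-mass gains expectation under P at no cost
under Q. -/
theorem fDivBar_eq_top_of_not_absCont (hPQ : ¬ P.AbsCont Q) : fDivBar f P Q = ⊤ := by
  simp only [FinAddProb.AbsCont, not_forall] at hPQ
  obtain ⟨E, hE, hQ, hPE⟩ := hPQ
  have hpos : 0 < P.mass E := lt_of_le_of_ne (P.mass_nonneg E hE) (Ne.symm hPE)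
  obtain ⟨s, t, hst⟩ := exists_conj_le hf
  rw [fDivBar_eq_iSup hf, EReal.eq_top_iff_forall_lt]
  intro M
  -- Chosen so that τ·1_E + s has P-expectation M + 1 + t; its conjugate integral is at most t,
  -- which leaves at least M + 1.
  let τ : ℝ := (M + 1 - (s - t)) / P.mass E
  have hτ : τ * P.mass E = M + 1 - (s - t) := div_mul_cancel₀ _ hPE
  have hB1 : τ • E.indicator (fun _ => (1 : ℝ)) ∈ BoundedMeasurable Ω :=
    (boundedMeasurableSubmodule Ω).smul_mem τ (BoundedMeasurable.indicator hE)
  have hB := (boundedMeasurableSubmodule Ω).add_mem hB1 (BoundedMeasurable.const s)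
  have hexp : P.expect (τ • E.indicator (fun _ => (1 : ℝ)) + fun _ => s) = M + 1 + t := by
    rw [P.expect_add hB1 (BoundedMeasurable.const s),
      P.expect_smul τ (BoundedMeasurable.indicator hE), P.expect_indicator hE, P.expect_const, hτ]
    ring
  refine lt_of_lt_of_le ?_ (le_iSup₂ (f := fun g (_ : g ∈ BoundedMeasurable Ω) =>
        ((P.expect g : ℝ) : EReal) - eintegral Q (fun x => conj f (g x))) _ hB)
  have hle : eintegral Q (fun x => conj f ((τ • E.indicator (fun _ => (1 : ℝ)) + (fun _ => s : Ω → ℝ)) x))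
      ≤ t := by
    refine le_trans (eintegral_conj_mono hf (h := fun _ => s) ?_) (eintegral_conj_const hst)
    filter_upwards [measure_eq_zero_iff_ae_notMem.1 hQ] with x hx
    simp [hx]
  refine lt_of_lt_of_le ?_ (EReal.sub_le_sub le_rfl hle)
  rw [hexp, ← EReal.coe_sub, EReal.coe_lt_coe_iff]
  linarith

end Variational

/-! ### Hahn-Banach separation in algebraic form -/

/-- A convex cone of pairs which is nonnegative over zero contains a linear graph below it. -/
theorem exists_linear_le_of_cone {V : Type*} [AddCommGroup V] [Module ℝ V] (S : V → Set ℝ)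
    (hne : ∀ g, (S g).Nonempty) (hadd : ∀ g h, ∀ r ∈ S g, ∀ s ∈ S h, r + s ∈ S (g + h))
    (hsmul : ∀ c : ℝ, 0 < c → ∀ g, ∀ r ∈ S g, c * r ∈ S (c • g)) (hzero : ∀ r ∈ S 0, 0 ≤ r) :
    ∃ Λ : V →ₗ[ℝ] ℝ, ∀ g, ∀ r ∈ S g, Λ g ≤ r := by
  -- An element of S(-g) bounds S(g) below, since their sums lie in S(0). Hence g ↦ inf S(g) is a
  -- real sublinear functional, and Hahn-Banach extends zero from the trivial subspace.
  have hbdd : ∀ g, BddBelow (S g) := fun g => by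
    obtain ⟨s, hs⟩ := hne (-g)
    refine ⟨-s, fun r hr => ?_⟩
    have := hzero _ (add_neg_cancel g ▸ hadd _ _ r hr s hs)
    linarith
  have hle : ∀ c : ℝ, 0 < c → ∀ g, sInf (S (c • g)) ≤ c * sInf (S g) := fun c hc g => by
    rw [mul_comm, ← div_le_iff₀ hc]
    refine le_csInf (hne g) fun r hr => ?_
    rw [div_le_iff₀ hc, mul_comm]
    exact csInf_le (hbdd _) (hsmul c hc g r hr)
  obtain ⟨Λ, -, hΛ⟩ := exists_extension_of_le_sublinear (E := V) ⊥ (fun g => sInf (S g))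
    (fun c hc g => le_antisymm (hle c hc g) (by
      have := hle c⁻¹ (inv_pos.2 hc) (c • g)
      rw [inv_smul_smul₀ hc.ne'] at this
      calc c * sInf (S g) ≤ c * (c⁻¹ * sInf (S (c • g))) := by gcongr
        _ = sInf (S (c • g)) := mul_inv_cancel_left₀ hc.ne' _))
    (fun g h => by
      rw [← sub_le_iff_le_add]
      refine le_csInf (hne g) fun r hr => ?_
      rw [sub_le_comm]
      refine le_csInf (hne h) fun s hs => ?_
      have := csInf_le (hbdd (g + h)) (hadd g h r hr s hs)
      linarith)
    (fun x => by
      have hx : x = 0 := Subtype.ext ((Submodule.mem_bot ℝ).1 x.2)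
      rw [hx]
      simpa using le_csInf (hne 0) hzero)
  exact ⟨Λ, fun g r hr => (hΛ g).trans (csInf_le (hbdd g) hr)⟩

/-- Convex duality for a functional with values in the extended reals. -/
theorem exists_linear_le_of_convex {V F : Type*} [AddCommGroup V] [Module ℝ V] [AddCommGroup F]
    [Module ℝ F] (Ψ : V → EReal)
    (hΨ : ∀ g h (r s a b : ℝ), Ψ g ≤ r → Ψ h ≤ s → 0 ≤ a → 0 ≤ b → a + b = 1 →
      Ψ (a • g + b • h) ≤ ((a * r + b * s : ℝ) : EReal))
    (T : F →ₗ[ℝ] V) (ℓ : F →ₗ[ℝ] ℝ) {K : Set F} (hK : Convex ℝ K) {L : ℝ}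
    (hL : ∀ a ∈ K, ∀ p : ℝ, Ψ (T a) ≤ p → ℓ a - p ≤ L)
    (hfin : ∀ g, ∃ a ∈ K, ∃ p : ℝ, Ψ (g + T a) ≤ p) :
    ∃ Λ : V →ₗ[ℝ] ℝ, ∀ h (p : ℝ), Ψ h ≤ p → ∀ a ∈ K, Λ h - Λ (T a) ≤ p + L - ℓ a := by
  -- With Φ(g) the infimum over a in K of Ψ(g + Ta) + L - ℓ(a), this cone consists of upper bounds
  -- for the perspective Φ(tg)/t. `hL` says Φ(0) ≥ 0, and t = 1 recovers the required inequality.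
  obtain ⟨Λ, hΛ⟩ := exists_linear_le_of_cone
    (fun g => {r : ℝ | ∃ t : ℝ, 0 < t ∧ ∃ a ∈ K, Ψ (t • g + T a) ≤ ((t * r - L + ℓ a : ℝ) : EReal)})
    (fun g => by
      obtain ⟨a, ha, p, hp⟩ := hfin g
      refine ⟨p + L - ℓ a, 1, one_pos, a, ha, ?_⟩
      rw [one_smul]
      convert hp using 2
      ring)
    (by
      rintro g h r ⟨t, ht, a, ha, hr⟩ s ⟨u, hu, b, hb, hs⟩
      have htu : 0 < t + u := add_pos ht hu
      have h1 : u / (t + u) + t / (t + u) = 1 := by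
        rw [← add_div, add_comm u t, div_self htu.ne']
      have h0 := div_nonneg hu.le htu.le
      have h0' := div_nonneg ht.le htu.le
      -- The weights u/(t+u) and t/(t+u) bring tg and uh to the common scale tu/(t+u).
      refine ⟨t * u / (t + u), by positivity, (u / (t + u)) • a + (t / (t + u)) • b,
        hK ha hb h0 h0' h1, ?_⟩
      convert hΨ _ _ _ _ _ _ hr hs h0 h0' h1 using 2
      · rw [map_add, map_smul, map_smul]
        module
      · rw [map_add, map_smul, map_smul, smul_eq_mul, smul_eq_mul]
        linear_combination (-L) * h1.symm)
    (by
      rintro c hc g r ⟨t, ht, a, ha, hr⟩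
      refine ⟨t / c, div_pos ht hc, a, ha, ?_⟩
      convert hr using 2
      · rw [smul_smul, div_mul_cancel₀ _ hc.ne']
      · rw [← mul_assoc, div_mul_cancel₀ _ hc.ne'])
    (by
      rintro r ⟨t, ht, a, ha, hr⟩
      rw [smul_zero, zero_add] at hr
      have := hL a ha _ hr
      exact nonneg_of_mul_nonneg_right (by linarith : 0 ≤ t * r) ht)
  refine ⟨Λ, fun h p hp a ha => ?_⟩
  rw [← map_sub]
  refine hΛ _ _ ⟨1, one_pos, a, ha, ?_⟩
  rw [one_smul, sub_add_cancel]
  convert hp using 2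
  ring

/-! ### Duality between linear discriminators and finitely additive probabilities -/

section Duality

variable {Ω : Type*} [MeasurableSpace Ω] {n : ℕ}

/-- The affine discriminators as a linear map of their parameters. -/
def discriminator {φ : Fin n → Ω → ℝ} (hφ : ∀ i, φ i ∈ BoundedMeasurable Ω) :
    EuclideanSpace ℝ (Fin n) × ℝ →ₗ[ℝ] boundedMeasurableSubmodule Ω where
  toFun p := ⟨fun x => ∑ i, p.1 i * φ i x + p.2, BoundedMeasurable.affine hφ p.1 p.2⟩
  map_add' p q := by
    ext x
    simp only [Prod.fst_add, Prod.snd_add, PiLp.add_apply, Submodule.coe_add, Pi.add_apply, add_mul,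
      Finset.sum_add_distrib]
    ring
  map_smul' c p := by
    ext x
    simp only [Prod.smul_fst, Prod.smul_snd, PiLp.smul_apply, Submodule.coe_smul, Pi.smul_apply,
      smul_eq_mul, RingHom.id_apply, mul_add, Finset.mul_sum, mul_assoc]

theorem convex_discriminator_params (R : ℝ) :
    Convex ℝ {p : EuclideanSpace ℝ (Fin n) × ℝ | ‖p.1‖ ≤ R} := by
  intro p hp q hq a b ha hb hab
  have := convex_closedBall (0 : EuclideanSpace ℝ (Fin n)) R (mem_closedBall_zero_iff.2 hp)
    (mem_closedBall_zero_iff.2 hq) ha hb hab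
  exact mem_closedBall_zero_iff.1 this

/-- The constant b cancels because both masses are normalised; only the moments of φ differ. -/
theorem expect_sub_expect_affine {φ : Fin n → Ω → ℝ} (hφ : ∀ i, φ i ∈ BoundedMeasurable Ω)
    (P P' : FinAddProb Ω) (a : EuclideanSpace ℝ (Fin n)) (b : ℝ) :
    P.expect (fun x => ∑ i, a i * φ i x + b) =
      inner ℝ (P.expectVec φ - P'.expectVec φ) a + P'.expect (fun x => ∑ i, a i * φ i x + b) := by
  rw [P.expect_affine hφ, P'.expect_affine hφ]
  simp only [PiLp.inner_apply, FinAddProb.expectVec, PiLp.sub_apply, RCLike.inner_apply, conj_trivial,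
    mul_sub, Finset.sum_sub_distrib]
  ring

variable {f : ℝ → EReal} (hf : IsDivergenceFunction f) {Q : Measure Ω} [IsProbabilityMeasure Q]
  {φ : Fin n → Ω → ℝ} (hφ : ∀ i, φ i ∈ BoundedMeasurable Ω)

include hf hφ

theorem linearFDiv_le (R : ℝ) (P P' : FinAddProb Ω) :
    linearFDiv f φ {a | ‖a‖ ≤ R} P Q ≤
      ((R * ‖P.expectVec φ - P'.expectVec φ‖ : ℝ) : EReal) + fDivBar f P' Q := by
  refine iSup₂_le fun a ha => iSup_le fun b => ?_
  rw [expect_sub_expect_affine hφ P P' a b, EReal.coe_add, sub_eq_add_neg, add_assoc,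
    ← sub_eq_add_neg, fDivBar_eq_iSup hf]
  refine add_le_add (EReal.coe_le_coe_iff.2 ?_) (le_iSup₂
    (f := fun g (_ : g ∈ BoundedMeasurable Ω) =>
        ((P'.expect g : ℝ) : EReal) - eintegral Q (fun x => conj f (g x))) _
    (BoundedMeasurable.affine hφ a b))
  refine (real_inner_le_norm _ _).trans ?_
  rw [mul_comm]
  exact mul_le_mul_of_nonneg_right ha (norm_nonneg _)

theorem exists_le_linearFDiv {R : ℝ} (hR : 0 < R) (P : FinAddProb Ω) {L : ℝ}
    (hL : linearFDiv f φ {a | ‖a‖ ≤ R} P Q ≤ L) : ∃ P' : FinAddProb Ω,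
      ((R * ‖P.expectVec φ - P'.expectVec φ‖ : ℝ) : EReal) + fDivBar f P' Q ≤ L := by
  obtain ⟨s, t, hst⟩ := exists_conj_le hf
  let one : boundedMeasurableSubmodule Ω := ⟨_, BoundedMeasurable.const 1⟩
  let T := discriminator hφ
  have hT : ∀ b : ℝ, T (0, b) = b • one := fun b => by
    ext x
    simp [T, discriminator, one]
  obtain ⟨Λ, hΛ⟩ := exists_linear_le_of_convex
    (fun g : boundedMeasurableSubmodule Ω => eintegral Q (fun x => conj f (g.1 x)))
    (fun g h r s a b hr hs ha hb hab => eintegral_conj_convex hf g.2 h.2 hr hs ha hb hab)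
    T (P.expectLinear ∘ₗ T) (convex_discriminator_params R) (L := L)
    (fun p hp r hr => by
      have h1 : ((P.expect (T p).1 : ℝ) : EReal) - eintegral Q (fun x => conj f ((T p).1 x)) ≤ L :=
        (iSup_le_iff.1 (iSup₂_le_iff.1 hL p.1 hp)) p.2
      have h2 := (EReal.sub_le_sub le_rfl hr).trans h1
      rw [← EReal.coe_sub, EReal.coe_le_coe_iff] at h2
      exact h2)
    (fun g => by
      obtain ⟨-, C, hC⟩ := g.2
      -- As g ≤ C, the shift by s - C brings g below the constant s, where the conjugate is at most
      -- t.
      refine ⟨(0, s - C), by simpa using hR.le, t, ?_⟩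
      refine le_trans (eintegral_conj_mono hf (ae_of_all _ fun x => ?_)) (eintegral_conj_const hst)
      rw [hT]
      have := (abs_le.1 (hC x)).2
      simp only [Submodule.coe_add, Submodule.coe_smul, Pi.add_apply, Pi.smul_apply, one,
        smul_eq_mul]
      linarith)
  have hzero : ∀ h (p : ℝ), eintegral Q (fun x => conj f (h.1 x)) ≤ p → ∀ b : ℝ,
      Λ h - b * Λ one ≤ p + L - b := fun h p hp b => by
    have := hΛ h p hp (0, b) (by simpa using hR.le)
    rw [LinearMap.comp_apply, hT, map_smul, map_smul, smul_eq_mul, smul_eq_mul] at this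
    rwa [show P.expectLinear one = 1 from P.expect_const 1, mul_one] at this
  have hs : eintegral Q (fun x => conj f ((s • one).1 x)) ≤ t := by
    simpa [one] using eintegral_conj_const (Q := Q) hst
  have hone : Λ one = 1 := by
    by_contra hne
    have h1 : 1 - Λ one ≠ 0 := sub_ne_zero.2 (Ne.symm hne)
    -- The bound is affine in b with slope 1 - Λ(1) on the left, so it can hold for all b only if
    -- that slope is 0; this b exceeds it by 1.
    have h2 := hzero _ t hs ((t + L - Λ (s • one) + 1) / (1 - Λ one))
    have h3 := div_mul_cancel₀ (t + L - Λ (s • one) + 1) h1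
    linarith
  have hpos : ∀ g : boundedMeasurableSubmodule Ω, (∀ x, 0 ≤ g.1 x) → 0 ≤ Λ g := fun g hg => by
    by_contra! hneg
    -- For g ≥ 0 the functions s - r·g stay below s, so their conjugate integrals stay below t,
    -- while a negative Λ(g) would make Λ(s - r·g) unbounded as r grows.
    have h1 : ∀ r : ℝ, 0 ≤ r → Λ (s • one) - r * Λ g ≤ t + L := fun r hr => by
      have := hzero (s • one - r • g) t (le_trans (eintegral_conj_mono hf (ae_of_all _ fun x => by
        simpa using mul_nonneg hr (hg x))) hs) 0
      simpa using this
    obtain ⟨k, hk⟩ := exists_nat_gt ((t + L - Λ (s • one)) / -Λ g)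
    rw [div_lt_iff₀ (neg_pos.2 hneg)] at hk
    linarith [h1 k (Nat.cast_nonneg k)]
  obtain ⟨P', hP'⟩ := exists_finAddProb_expect_eq Λ hpos hone
  refine ⟨P', ?_⟩
  set v := P.expectVec φ - P'.expectVec φ with hv
  -- This a attains equality in Cauchy-Schwarz on the ball of radius R.
  obtain ⟨a, ha, hav⟩ : ∃ a : EuclideanSpace ℝ (Fin n), ‖a‖ ≤ R ∧ inner ℝ v a = R * ‖v‖ := by
    rcases eq_or_ne v 0 with h0 | h0
    · exact ⟨0, by simpa using hR.le, by simp [h0]⟩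
    · have := norm_ne_zero_iff.2 h0
      refine ⟨(R / ‖v‖) • v, ?_, ?_⟩
      · rw [norm_smul, Real.norm_of_nonneg (by positivity), div_mul_cancel₀ _ this]
      · rw [inner_smul_right, real_inner_self_eq_norm_sq]
        field_simp
  have hmain : fDivBar f P' Q ≤ ((L - R * ‖v‖ : ℝ) : EReal) := by
    rw [fDivBar_eq_iSup hf]
    refine iSup₂_le fun h hh => ?_
    rcases eq_or_ne (eintegral Q (fun x => conj f (h x))) ⊤ with h1 | h1
    · rw [h1, EReal.sub_top]
      exact bot_le
    · obtain ⟨-, -, v1⟩ := eintegral_conj_eq hf hh h1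
      have h2 := hΛ ⟨h, hh⟩ _ v1.le (a, 0) ha
      have h3 : Λ (T (a, 0)) = P'.expect (fun x => ∑ i, a i * φ i x + 0) :=
        (hP' _ (T (a, 0)).2).symm
      have h4 : (P.expectLinear ∘ₗ T) (a, 0) = P.expect (fun x => ∑ i, a i * φ i x + 0) := rfl
      have h5 := expect_sub_expect_affine hφ P P' a 0
      rw [← hv, hav] at h5
      rw [v1, ← EReal.coe_sub, EReal.coe_le_coe_iff, hP' h hh]
      linarith
  refine (add_le_add le_rfl hmain).trans ?_
  rw [← EReal.coe_add, EReal.coe_le_coe_iff]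
  linarith

theorem linearFDiv_eq_iInf {R : ℝ} (hR : 0 < R) (P : FinAddProb Ω) :
    linearFDiv f φ {a | ‖a‖ ≤ R} P Q = ⨅ P' : FinAddProb Ω,
      ((R * ‖P.expectVec φ - P'.expectVec φ‖ : ℝ) : EReal) + fDivBar f P' Q := by
  refine le_antisymm (le_iInf fun P' => linearFDiv_le hf hφ R P P') ?_
  -- Real L above the left-hand side suffice; if it is ⊤ there is none and nothing remains to prove.
  rw [← EReal.le_of_forall_lt_iff_le]
  intro L hL
  obtain ⟨P', hP'⟩ := exists_le_linearFDiv hf hφ hR P hL.le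
  exact iInf_le_of_le P' hP'

theorem linearFDiv_eq_iInf_absCont {R : ℝ} (hR : 0 < R) (P : FinAddProb Ω) :
    linearFDiv f φ {a | ‖a‖ ≤ R} P Q = ⨅ (P' : FinAddProb Ω) (_ : P'.AbsCont Q),
      ((R * ‖P.expectVec φ - P'.expectVec φ‖ : ℝ) : EReal) + fDivBar f P' Q := by
  rw [linearFDiv_eq_iInf hf hφ hR]
  refine iInf_congr fun P' => ?_
  by_cases h : P'.AbsCont Q
  · simp [h]
  · simp only [h, iInf_false, fDivBar_eq_top_of_not_absCont hf h]
    exact EReal.coe_add_top _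

end Duality

/-! ### The Kullback-Leibler case -/

section KullbackLeibler

theorem xLogX_of_nonneg {x : ℝ} (hx : 0 ≤ x) : xLogX x = ((x * Real.log x : ℝ) : EReal) :=
  if_neg hx.not_gt

theorem isDivergenceFunction_xLogX : IsDivergenceFunction xLogX where
  ne_bot x := by
    rw [xLogX]
    split_ifs
    · exact top_ne_bot
    · exact EReal.coe_ne_bot _
  convex x y a b ha hb hab := by
    have ha' : (0 : EReal) < a := EReal.coe_pos.2 ha
    have hb' : (0 : EReal) < b := EReal.coe_pos.2 hb
    have hbot : ∀ c z : ℝ, 0 ≤ z → (c : EReal) * xLogX z ≠ ⊥ := fun c z hz => by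
      rw [xLogX_of_nonneg hz, ← EReal.coe_mul]
      exact EReal.coe_ne_bot _
    have htop : ∀ z : ℝ, z < 0 → xLogX z = ⊤ := fun z hz => if_pos hz
    rcases lt_or_ge x 0 with hx | hx
    · rcases lt_or_ge y 0 with hy | hy
      · rw [htop x hx, htop y hy, EReal.mul_top_of_pos ha', EReal.mul_top_of_pos hb']
        exact le_top
      · rw [htop x hx, EReal.mul_top_of_pos ha', EReal.top_add_of_ne_bot (hbot b y hy)]
        exact le_top
    · rcases lt_or_ge y 0 with hy | hy
      · rw [htop y hy, EReal.mul_top_of_pos hb', EReal.add_top_of_ne_bot (hbot a x hx)]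
        exact le_top
      · rw [xLogX_of_nonneg hx, xLogX_of_nonneg hy, xLogX_of_nonneg (by positivity),
          ← EReal.coe_mul, ← EReal.coe_mul, ← EReal.coe_add, EReal.coe_le_coe_iff]
        exact Real.convexOn_mul_log.2 hx hy ha.le hb.le hab
  lsc x y hy := by
    change y < xLogX x at hy
    change ∀ᶠ z in 𝓝 x, y < xLogX z
    rcases lt_or_ge x 0 with hx | hx
    · filter_upwards [Iio_mem_nhds hx] with z hz
      rw [xLogX, if_pos hx] at hy
      rwa [xLogX, if_pos (Set.mem_Iio.1 hz)]
    · rw [xLogX_of_nonneg hx] at hy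
      have hc : Continuous fun z : ℝ => ((z * Real.log z : ℝ) : EReal) :=
        continuous_coe_real_ereal.comp Real.continuous_mul_log
      filter_upwards [hc.continuousAt.eventually (lt_mem_nhds hy)] with z hz
      rcases lt_or_ge z 0 with h | h
      · rw [xLogX, if_pos h]
        exact hz.trans_le le_top
      · rwa [xLogX_of_nonneg h]
  map_one := by
    rw [xLogX_of_nonneg zero_le_one]
    simp
  finite_near_one := by
    filter_upwards [Ioi_mem_nhds zero_lt_one] with x hx
    rw [xLogX_of_nonneg (le_of_lt hx)]
    exact EReal.coe_ne_top _
  top_of_neg x hx := if_pos hx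

/-- The maximiser of xs - x ln x is x = exp(s - 1); the upper bound is 1 + u ≤ exp(u) at u = s - 1 -
ln x. -/
theorem conj_xLogX (s : ℝ) : conj xLogX s = ((Real.exp (s - 1) : ℝ) : EReal) := by
  refine le_antisymm ?_ ?_
  · rw [conj_le_iff isDivergenceFunction_xLogX]
    intro x r hr
    rcases lt_or_ge x 0 with hx | hx
    · rw [xLogX, if_pos hx] at hr
      exact absurd hr (EReal.coe_lt_top r).not_ge
    · rw [xLogX_of_nonneg hx, EReal.coe_le_coe_iff] at hr
      rcases hx.eq_or_lt with rfl | hx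
      · have := Real.exp_pos (s - 1)
        simp only [zero_mul] at hr ⊢
        linarith
      · have h1 := Real.add_one_le_exp (s - 1 - Real.log x)
        rw [Real.exp_sub _ (Real.log x), Real.exp_log hx, le_div_iff₀ hx] at h1
        nlinarith
  · refine le_trans ?_ (le_iSup _ (Real.exp (s - 1)))
    rw [xLogX_of_nonneg (Real.exp_pos _).le, ← EReal.coe_sub, EReal.coe_le_coe_iff, Real.log_exp]
    linarith

variable {Ω : Type*} [MeasurableSpace Ω] {Q : Measure Ω} [IsProbabilityMeasure Q]

/-- `klFun` differs from x ln x by 1 - x, whose integral at the density vanishes. Without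
integrability both sides are ⊤, the left one because an affine minorant controls the negative part.
-/
theorem fDiv_xLogX_eq_klDiv {μ : Measure Ω} [IsProbabilityMeasure μ] (hac : μ ≪ Q) :
    fDiv xLogX μ Q = ((InformationTheory.klDiv μ Q : ℝ≥0∞) : EReal) := by
  let ρ : Ω → ℝ := fun x => (μ.rnDeriv Q x).toReal
  have hρ0 : ∀ x, 0 ≤ ρ x := fun x => ENNReal.toReal_nonneg
  have hρ : Integrable ρ Q := Measure.integrable_toReal_rnDeriv
  have hρ1 : ∫ x, ρ x ∂Q = 1 := by
    simp [ρ, Measure.integral_toReal_rnDeriv hac]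
  have hm : Measurable fun x => xLogX (ρ x) := isDivergenceFunction_xLogX.lsc.measurable.comp
    (Measure.measurable_rnDeriv μ Q).ennreal_toReal
  have hfd : fDiv xLogX μ Q = eintegral Q fun x => ((ρ x * Real.log (ρ x) : ℝ) : EReal) := by
    simp only [fDiv, ← xLogX_of_nonneg (hρ0 _), ρ]
  have hkl : ∀ x, InformationTheory.klFun (ρ x) = ρ x * Real.log (ρ x) + 1 - ρ x := fun _ => rfl
  rw [InformationTheory.klDiv_eq_lintegral_klFun_of_ac hac]
  by_cases hi : Integrable (fun x => ρ x * Real.log (ρ x)) Q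
  · have hi2 : Integrable (fun x => InformationTheory.klFun (ρ x)) Q :=
      (hi.add (integrable_const 1)).sub hρ
    have h1 : ∫ x, InformationTheory.klFun (ρ x) ∂Q = ∫ x, ρ x * Real.log (ρ x) ∂Q := by
      simp only [hkl]
      have hi1 : Integrable (fun x => ρ x * Real.log (ρ x) + 1) Q := hi.add (integrable_const 1)
      rw [integral_sub hi1 hρ, integral_add hi (integrable_const 1), hρ1]
      simp
    have h0 : ∀ x, 0 ≤ InformationTheory.klFun (ρ x) := fun x =>
      InformationTheory.klFun_nonneg (hρ0 x)
    rw [hfd, eintegral_coe hi, ← ofReal_integral_eq_lintegral_ofReal hi2 (ae_of_all _ h0), h1,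
      EReal.coe_ennreal_ofReal, max_eq_left]
    rw [← h1]
    exact integral_nonneg h0
  · have htop : ∫⁻ x, ENNReal.ofReal (InformationTheory.klFun (ρ x)) ∂Q = ∞ := by
      by_contra hne
      refine hi ?_
      have h1 := integrable_toReal_of_lintegral_ne_top
        (InformationTheory.measurable_klFun.comp
          (Measure.measurable_rnDeriv μ Q).ennreal_toReal).ennreal_ofReal.aemeasurable hne
      refine ((h1.sub (integrable_const 1)).add hρ).congr (ae_of_all _ fun x => ?_)
      have : (ENNReal.ofReal (InformationTheory.klFun (ρ x))).toReal = _ :=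
        ENNReal.toReal_ofReal (InformationTheory.klFun_nonneg (hρ0 x))
      simp only [Pi.add_apply, Pi.sub_apply]
      change (ENNReal.ofReal (InformationTheory.klFun (ρ x))).toReal - 1 + ρ x = _
      rw [this, hkl]
      ring
    rw [htop, EReal.coe_ennreal_top]
    by_contra hne
    obtain ⟨s, t, hst⟩ := exists_conj_le isDivergenceFunction_xLogX
    have h1 := (eintegral_eq_integral_toReal hm ((hρ.mul_const s).sub (integrable_const t))
      (ae_of_all _ fun x => affine_le_of_conj_le isDivergenceFunction_xLogX hst _) hne).1
    refine hi (h1.congr (ae_of_all _ fun x => ?_))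
    simp only [xLogX_of_nonneg (hρ0 x), EReal.toReal_coe]

theorem fDivBar_xLogX_eq_klDivBar {P : FinAddProb Ω} (hPQ : P.AbsCont Q) :
    fDivBar xLogX P Q = klDivBar P Q := by
  by_cases hP : P.IsCountablyAdditive
  · have := P.isProbabilityMeasure_toMeasure hP
    rw [fDivBar, dif_pos ⟨hP, hPQ⟩, klDivBar, dif_pos hP]
    exact fDiv_xLogX_eq_klDiv (hPQ.absolutelyContinuous hP)
  · rw [fDivBar, dif_neg fun h => hP h.1, klDivBar, dif_neg hP]
    refine iSup_congr fun h => iSup_congr fun hh => ?_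
    obtain ⟨hm, C, hC⟩ := hh
    have hi : Integrable (fun x => Real.exp (h x - 1)) Q :=
      Integrable.of_bound (Real.measurable_exp.comp (hm.sub_const 1)).aestronglyMeasurable
        (Real.exp (C - 1)) (ae_of_all _ fun x => by
          rw [Real.norm_of_nonneg (Real.exp_pos _).le, Real.exp_le_exp]
          linarith [(abs_le.1 (hC x)).2])
    simp only [conj_xLogX]
    rw [eintegral_coe hi, EReal.coe_sub]

end KullbackLeibler

end

end FGAN

theorem corollary2 {Ω : Type*} [MeasurableSpace Ω] (f : ℝ → EReal)
    (hf : FGAN.IsDivergenceFunction f) (n : ℕ) (φ : Fin n → Ω → ℝ)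
    (hφ : ∀ i, φ i ∈ FGAN.BoundedMeasurable Ω) (R : ℝ) (hR : 0 < R)
    (P : FGAN.FinAddProb Ω) (Q : Measure Ω) [IsProbabilityMeasure Q] :
    (FGAN.linearFDiv f φ {a | ‖a‖ ≤ R} P Q =
        ⨅ P' : FGAN.FinAddProb Ω,
          ((R * ‖P.expectVec φ - P'.expectVec φ‖ : ℝ) : EReal) + FGAN.fDivBar f P' Q) ∧
    (FGAN.linearFDiv f φ {a | ‖a‖ ≤ R} P Q =
        ⨅ (P' : FGAN.FinAddProb Ω) (_ : P'.AbsCont Q),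
          ((R * ‖P.expectVec φ - P'.expectVec φ‖ : ℝ) : EReal) + FGAN.fDivBar f P' Q) ∧
    (∀ P' : FGAN.FinAddProb Ω, P'.AbsCont Q →
        FGAN.fDivBar FGAN.xLogX P' Q = FGAN.klDivBar P' Q) ∧
    (FGAN.linearFDiv FGAN.xLogX φ {a | ‖a‖ ≤ R} P Q =
        ⨅ (P' : FGAN.FinAddProb Ω) (_ : P'.AbsCont Q),
          ((R * ‖P.expectVec φ - P'.expectVec φ‖ : ℝ) : EReal) + FGAN.klDivBar P' Q) := by
  have habs := FGAN.linearFDiv_eq_iInf_absCont FGAN.isDivergenceFunction_xLogX (Q := Q) hφ hR P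
  refine ⟨FGAN.linearFDiv_eq_iInf hf hφ hR P, FGAN.linearFDiv_eq_iInf_absCont hf hφ hR P,
    fun P' hP' => FGAN.fDivBar_xLogX_eq_klDivBar hP', habs.trans ?_⟩
  refine iInf_congr fun P' => iInf_congr fun hP' => ?_
  rw [FGAN.fDivBar_xLogX_eq_klDivBar hP']
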